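/- Let $\gamma\in\mathbb R$ and, for $N\ge 0$, let $S_N$ act on $\mathbb R^N$ by $(w\mathbf x)_j=x_{w^{-1}(j)}$ and on functions $f:\mathbb R^N\to\mathbb C$ by $(wf)(\mathbf x)=f(w^{-1}\mathbf x)$. Put $\mathbb R^N_+=\{\mathbf x\in\mathbb R^N: x_1>\dots>x_N\}$, and let $\mathscr{CB}^\infty(\mathbb R^N)$ be the space of continuous functions $\mathbb R^N\to\mathbb C$ that are smooth on each alcove $w\mathbb R^N_+$, $w\in S_N$. Wavefunctions. For $1\le j<N$ let $s_j$ be the transposition of $j$ and $j+1$, and for continuous $f$ let $$(s_j^\gamma f)(\mathbf x)=f(s_j\mathbf x)+\gamma\int_0^{x_j-x_{j+1}}f\bigl(\mathbf x-y(\mathbf e_j-\mathbf e_{j+1})\bigr)\,dy .$$ For $w=s_{i_1}\cdots s_{i_l}\in S_N$ put $w^\gamma=s_{i_1}^\gamma\cdots s_{i_l}^\gamma$ (this does not depend on the decomposition). The propagation operator $P^\gamma_{(N)}$ sends a continuous function $f$ on $\mathbb R^N$ to the continuous function on $\mathbb R^N$ given by $P^\gamma_{(N)}f=w^{-1}w^\gamma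 f$ on $w^{-1}\mathbb R^N_+$ for every $w\in S_N$. For $\boldsymbol\lambda\in\mathbb C^N$ let $\mathrm e^{\mathrm i\boldsymbol\lambda}(\mathbf x)=\exp(\mathrm i\sum_j\lambda_jx_j)$ and $\psi_{\boldsymbol\lambda}=\psi_{\lambda_1,\dots,\lambda_N}=P^\gamma_{(N)}\mathrm e^{\mathrm i\boldsymbol\lambda}$. For $N=0$ this is the constant $\psi_\emptyset=1$. Creation operators. Let $\mu\in\mathbb C$, $0\le n\le N$, and let $\mathbf i=(i_1,\dots,i_n)$ be a tuple of distinct elements of $\{1,\dots,N\}$. For $f$ on $\mathbb R^N$ and $\mathbf y\in\mathbb R^n$ let $f_{\mathbf i,\mathbf y}$ be the function obtained from $f$ by replacing its $i_m$-th argument with $y_m$ for $m=1,\dots,n$. For $f\in\mathscr C(\mathbb R^N)$ and $\mathbf x\in\mathbb R^{N+1}$ define $$(\hat e^-_{\mu;\mathbf i}f)(\mathbf x)=\mathrm e^{\mathrm i\mu x_{N+1}}\int_{x_{i_1}}^{x_{i_0}}\!dy_1\cdots\int_{x_{i_n}}^{x_{i_{n-1}}}\!dy_n\ \prod_{m=1}^n\mathrm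 e^{\mathrm i\mu(x_{i_m}-y_m)}\; f_{\mathbf i,\mathbf y}(x_1,\dots,x_N)$$ with $i_0=N+1$, if $x_{N+1}>x_{i_1}>\dots>x_{i_n}$, and $(\hat e^-_{\mu;\mathbf i}f)(\mathbf x)=0$ otherwise. With $k_m=i_m+1$ for $1\le m\le n$ and $k_{n+1}=1$, define $$(\hat e^+_{\mu;\mathbf i}f)(\mathbf x)=\mathrm e^{\mathrm i\mu x_{1}}\int_{x_{k_2}}^{x_{k_1}}\!dy_1\cdots\int_{x_{k_{n+1}}}^{x_{k_n}}\!dy_n\ \prod_{m=1}^n\mathrm e^{\mathrm i\mu(x_{k_m}-y_m)}\; f_{\mathbf i,\mathbf y}(x_2,\dots,x_{N+1})$$ if $x_{k_1}>\dots>x_{k_n}>x_1$, and $(\hat e^+_{\mu;\mathbf i}f)(\mathbf x)=0$ otherwise. Finally let $b^\pm_\mu=\sum_{n=0}^N\gamma^n\sum_{\mathbf i}\hat e^\pm_{\mu;\mathbf i}$, where $\mathbf i$ runs over all $n$-tuples of distinct elements of $\{1,\dots,N\}$. It maps functions on $\mathbb R^N$ to functions on $\mathbb R^{N+1}$. Theorem.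 For all $N\ge 0$ and $(\lambda_1,\dots,\lambda_{N+1})\in\mathbb C^{N+1}$, $$\psi_{\lambda_1,\dots,\lambda_{N+1}}=b^-_{\lambda_{N+1}}\psi_{\lambda_1,\dots,\lambda_N}=b^+_{\lambda_1}\psi_{\lambda_2,\dots,\lambda_{N+1}} .$$ Hence, for all $N\ge 0$ and $(\lambda_1,\dots,\lambda_N)\in\mathbb C^N$, $$\psi_{\lambda_1,\dots,\lambda_N}=b^-_{\lambda_N}\cdots b^-_{\lambda_1}\psi_\emptyset=b^+_{\lambda_1}\cdots b^+_{\lambda_N}\psi_\emptyset\in\mathscr{CB}^\infty(\mathbb R^N).$$ -/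

import Mathlib

open scoped ContDiff

noncomputable section

namespace QNLS

/-! ### The action of the symmetric group, alcoves and function spaces -/

/-- The left action of `S_N` on `ℝ^N`: `(w x)_j = x_{w⁻¹ j}`. -/
def permAct {N : ℕ} (w : Equiv.Perm (Fin N)) (x : Fin N → ℝ) : Fin N → ℝ :=
  fun j => x (w⁻¹ j)

/-- The left action of `S_N` on functions: `(w f)(x) = f (w⁻¹ x)`. -/
def permFun {N : ℕ} (w : Equiv.Perm (Fin N)) (f : (Fin N → ℝ) → ℂ) : (Fin N → ℝ) → ℂ :=
  fun x => f (permAct w⁻¹ x)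

/-- The fundamental alcove `ℝ^N_+ = {x | x_1 > ⋯ > x_N}`. -/
def fundamentalAlcove (N : ℕ) : Set (Fin N → ℝ) :=
  {x | ∀ j k : Fin N, j < k → x k < x j}

/-- The alcove `w ℝ^N_+`. -/
def alcove {N : ℕ} (w : Equiv.Perm (Fin N)) : Set (Fin N → ℝ) :=
  permAct w '' fundamentalAlcove N

/-- The space `CB^∞(ℝ^N)`: continuous functions on `ℝ^N` that are smooth on every alcove. -/
def CBInf (N : ℕ) : Set ((Fin N → ℝ) → ℂ) :=
  {f | Continuous f ∧ ∀ w : Equiv.Perm (Fin N), ContDiffOn ℝ ∞ f (alcove w)}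

/-! ### Integral-reflection operators and the propagation operator -/

/-- `(I_{jk} f)(x) = ∫_0^{x_j - x_k} f (x - y (e_j - e_k)) dy`. -/
def integralOp {N : ℕ} (j k : Fin N) (f : (Fin N → ℝ) → ℂ) : (Fin N → ℝ) → ℂ :=
  fun x => ∫ y in (0 : ℝ)..(x j - x k), f (x - y • (Pi.single j (1 : ℝ) - Pi.single k (1 : ℝ)))

/-- The index `j`, for `j` labelling one of the `N - 1` simple transpositions. -/
def lowIdx {N : ℕ} (j : Fin (N - 1)) : Fin N := ⟨j, by omega⟩

/-- The index `j + 1`, for `j` labelling one of the `N - 1` simple transpositions. -/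
def highIdx {N : ℕ} (j : Fin (N - 1)) : Fin N := ⟨j + 1, by omega⟩

/-- The simple transposition `s_j = s_{j,j+1}`. -/
def simpleTransposition {N : ℕ} (j : Fin (N - 1)) : Equiv.Perm (Fin N) :=
  Equiv.swap (lowIdx j) (highIdx j)

/-- The integral-reflection operator `s_j^γ = s_j + γ I_{j,j+1}`. -/
def integralReflection (γ : ℝ) {N : ℕ} (j : Fin (N - 1)) (f : (Fin N → ℝ) → ℂ) :
    (Fin N → ℝ) → ℂ :=
  fun x => permFun (simpleTransposition j) f x + (γ : ℂ) * integralOp (lowIdx j) (highIdx j) f x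

/-- The operator `s_{i_1}^γ ⋯ s_{i_l}^γ` attached to a word `i_1, …, i_l`. -/
def wordOp (γ : ℝ) {N : ℕ} (l : List (Fin (N - 1))) (f : (Fin N → ℝ) → ℂ) : (Fin N → ℝ) → ℂ :=
  l.foldr (fun j g => integralReflection γ j g) f

/-- Every permutation is a product of simple transpositions. -/
theorem exists_word {N : ℕ} (w : Equiv.Perm (Fin N)) :
    ∃ l : List (Fin (N - 1)), (l.map simpleTransposition).prod = w := by
  cases N with
  | zero => exact ⟨[], Subsingleton.elim _ _⟩
  | succ n =>
    have h : w ∈ Submonoid.closure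
        (Set.range (simpleTransposition : Fin (n + 1 - 1) → Equiv.Perm (Fin (n + 1)))) := by
      have h1 := Equiv.Perm.mclosure_swap_castSucc_succ n
      have h2 : (simpleTransposition : Fin (n + 1 - 1) → Equiv.Perm (Fin (n + 1))) =
          fun i : Fin n => Equiv.swap i.castSucc i.succ := rfl
      rw [h2, h1]
      trivial
    obtain ⟨l, hl, rfl⟩ := Submonoid.exists_list_of_mem_closure h
    clear h
    induction l with
    | nil => exact ⟨[], rfl⟩
    | cons a l ih =>
      obtain ⟨j, hj⟩ := hl a (by simp)
      obtain ⟨l', hl'⟩ := ih (fun y hy => hl y (by simp [hy]))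
      exact ⟨j :: l', by simp [hj, hl']⟩

/-- The operator `w^γ = s_{i_1}^γ ⋯ s_{i_l}^γ` for a decomposition `w = s_{i_1} ⋯ s_{i_l}`. On
continuous functions it does not depend on the decomposition, so an arbitrary one is chosen. -/
def permGamma (γ : ℝ) {N : ℕ} (w : Equiv.Perm (Fin N)) (f : (Fin N → ℝ) → ℂ) :
    (Fin N → ℝ) → ℂ :=
  wordOp γ (exists_word w).choose f

/-- A permutation `w` such that `w x` has (weakly) decreasing coordinates, so that `x` lies in the
closure of `w⁻¹ ℝ^N_+`. For regular `x` it is the only one. -/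
def sortingPerm {N : ℕ} (x : Fin N → ℝ) : Equiv.Perm (Fin N) :=
  (Tuple.sort (fun j => -x j))⁻¹

/-- The propagation operator `P^γ_{(N)}`, given by `P^γ f = w⁻¹ w^γ f` on `w⁻¹ ℝ^N_+`
(see `propagation_eq`). On the hyperplanes `x_j = x_k` the same formula is used for the closure of an
alcove containing the point, which is the continuous extension when `f` is continuous. -/
def propagation (γ : ℝ) {N : ℕ} (f : (Fin N → ℝ) → ℂ) : (Fin N → ℝ) → ℂ :=
  fun x => permFun (sortingPerm x)⁻¹ (permGamma γ (sortingPerm x) f) x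

theorem propagation_eq (γ : ℝ) {N : ℕ} (f : (Fin N → ℝ) → ℂ) (w : Equiv.Perm (Fin N))
    {x : Fin N → ℝ} (hx : x ∈ alcove w⁻¹) :
    propagation γ f x = permFun w⁻¹ (permGamma γ w f) x := by
  obtain ⟨z, hz, rfl⟩ := hx
  have hsm : StrictMono (fun j => -z j) := fun j k hjk => neg_lt_neg (hz j k hjk)
  have hs : sortingPerm (permAct w⁻¹ z) = w := by
    unfold sortingPerm
    have h2 : Tuple.sort (fun j => -permAct w⁻¹ z j) = w⁻¹ := by
      symm
      rw [Tuple.eq_sort_iff]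
      have h3 : (fun j => -permAct w⁻¹ z j) ∘ (w⁻¹ : Equiv.Perm (Fin N)) = fun j => -z j := by
        funext j
        simp [permAct]
      refine ⟨by rw [h3]; exact hsm.monotone, fun i j hij he => ?_⟩
      have h4 := congrFun h3 i
      have h5 := congrFun h3 j
      simp only [Function.comp] at h4 h5
      rw [h4, h5] at he
      exact absurd he (ne_of_lt (hsm hij))
    rw [h2, inv_inv]
  unfold propagation
  rw [hs]

/-- The plane wave `e^{iλ}(x) = e^{i ∑ λ_j x_j}`. -/
def planeWave {N : ℕ} (lam : Fin N → ℂ) : (Fin N → ℝ) → ℂ :=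
  fun x => Complex.exp (Complex.I * ∑ j, lam j * (x j : ℂ))

/-- The non-symmetric wavefunction `ψ_λ = P^γ_{(N)} e^{iλ}`. -/
def psi (γ : ℝ) {N : ℕ} (lam : Fin N → ℂ) : (Fin N → ℝ) → ℂ :=
  propagation γ (planeWave lam)

/-! ### Non-symmetric creation operators -/

/-- The iterated integral `∫_{a_1}^{b_1} dy_1 ⋯ ∫_{a_n}^{b_n} dy_n F(y_1, …, y_n)`. -/
def iteratedIntegral : {n : ℕ} → (Fin n → ℝ) → (Fin n → ℝ) → ((Fin n → ℝ) → ℂ) → ℂ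
  | 0, _, _, F => F Fin.elim0
  | _ + 1, a, b, F =>
    ∫ y in (a 0)..(b 0), iteratedIntegral (Fin.tail a) (Fin.tail b) (fun ys => F (Fin.cons y ys))

/-- `x` with its coordinates `i_1, …, i_n` (distinct) replaced by `y_1, …, y_n`, so that
`(φ̄_i(y) f)(x) = f (substitute i y x)`. -/
def substitute {N n : ℕ} (i : Fin n ↪ Fin N) (y : Fin n → ℝ) (x : Fin N → ℝ) : Fin N → ℝ :=
  Function.extend i y x

open Classical in
/-- The step function `θ_p`, equal to `1` if `x_{p_0} > x_{p_1} > ⋯ > x_{p_n}` and to `0`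
otherwise. -/
def step {M n : ℕ} (p : Fin (n + 1) → Fin M) (x : Fin M → ℝ) : ℂ :=
  if ∀ m : Fin n, x (p m.succ) < x (p m.castSucc) then 1 else 0

/-- The tuple `(N + 1, i_1, …, i_n)` of labels in `{1, …, N + 1}`. -/
def minusLabels {N n : ℕ} (i : Fin n ↪ Fin N) : Fin (n + 1) → Fin (N + 1) :=
  Fin.cons (Fin.last N) (fun m => (i m).castSucc)

/-- The tuple `(i_1 + 1, …, i_n + 1, 1)` of labels in `{1, …, N + 1}`. -/
def plusLabels {N n : ℕ} (i : Fin n ↪ Fin N) : Fin (n + 1) → Fin (N + 1) :=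
  Fin.snoc (α := fun _ => Fin (N + 1)) (fun m => (i m).succ) 0

/-- The elementary creation operator `ê^-_{μ;i}`; the `m`-th integral runs over `y_m` from
`x_{i_m}` to `x_{i_{m-1}}`, where `i_0 = N + 1`. -/
def eMinus (μ : ℂ) {N n : ℕ} (i : Fin n ↪ Fin N) (f : (Fin N → ℝ) → ℂ) :
    (Fin (N + 1) → ℝ) → ℂ :=
  fun x =>
    Complex.exp (Complex.I * μ * (x (Fin.last N) : ℂ)) * step (minusLabels i) x *
      iteratedIntegral
        (fun m : Fin n => x (minusLabels i m.succ))
        (fun m : Fin n => x (minusLabels i m.castSucc))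
        (fun y => (∏ m, Complex.exp (Complex.I * μ * ((x (i m).castSucc : ℂ) - (y m : ℂ)))) *
          f (substitute i y (fun j => x j.castSucc)))

/-- The elementary creation operator `ê^+_{μ;i}`; the `m`-th integral runs over `y_m` from
`x_{i_{m+1}^+}` to `x_{i_m^+}`, where `j^+ = j + 1` and `i_{n+1}^+ = 1`. -/
def ePlus (μ : ℂ) {N n : ℕ} (i : Fin n ↪ Fin N) (f : (Fin N → ℝ) → ℂ) :
    (Fin (N + 1) → ℝ) → ℂ :=
  fun x =>
    Complex.exp (Complex.I * μ * (x 0 : ℂ)) * step (plusLabels i) x *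
      iteratedIntegral
        (fun m : Fin n => x (plusLabels i m.succ))
        (fun m : Fin n => x (plusLabels i m.castSucc))
        (fun y => (∏ m, Complex.exp (Complex.I * μ * ((x (i m).succ : ℂ) - (y m : ℂ)))) *
          f (substitute i y (fun j => x j.succ)))

/-- The creation operator `b^-_μ = ∑_{n=0}^N γ^n ∑_i ê^-_{μ;i}`, the inner sum running over all
`n`-tuples `i` of distinct labels in `{1, …, N}`. -/
def bMinus (γ : ℝ) (μ : ℂ) {N : ℕ} (f : (Fin N → ℝ) → ℂ) : (Fin (N + 1) → ℝ) → ℂ :=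
  fun x => ∑ n ∈ Finset.range (N + 1), (γ : ℂ) ^ n * ∑ i : Fin n ↪ Fin N, eMinus μ i f x

/-- The creation operator `b^+_μ = ∑_{n=0}^N γ^n ∑_i ê^+_{μ;i}`. -/
def bPlus (γ : ℝ) (μ : ℂ) {N : ℕ} (f : (Fin N → ℝ) → ℂ) : (Fin (N + 1) → ℝ) → ℂ :=
  fun x => ∑ n ∈ Finset.range (N + 1), (γ : ℂ) ^ n * ∑ i : Fin n ↪ Fin N, ePlus μ i f x

/-- The function `b^-_{λ_N} ⋯ b^-_{λ_1} ψ_∅`. -/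
def minusChain (γ : ℝ) : {N : ℕ} → (Fin N → ℂ) → ((Fin N → ℝ) → ℂ)
  | 0, _ => psi γ (Fin.elim0 : Fin 0 → ℂ)
  | N + 1, lam => bMinus γ (lam (Fin.last N)) (minusChain γ (fun j : Fin N => lam j.castSucc))

/-- The function `b^+_{λ_1} ⋯ b^+_{λ_N} ψ_∅`. -/
def plusChain (γ : ℝ) : {N : ℕ} → (Fin N → ℂ) → ((Fin N → ℝ) → ℂ)
  | 0, _ => psi γ (Fin.elim0 : Fin 0 → ℂ)
  | N + 1, lam => bPlus γ (lam 0) (plusChain γ (fun j : Fin N => lam j.succ))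

end QNLS

end

open scoped ContDiff

noncomputable section

namespace QNLS

/-! For fixed λ all the functions `w^γ e^{iλ}` are collected into one vector G(x) indexed by
permutations. This vector solves a linear system ∂_j G = A_j G with constant matrices A_j
(`dunklMatrix`). The A_j satisfy a degenerate affine Hecke cross relation with left translations
(`dunklMatrix_mul_leftShift`), and this forces them to commute (`dunklMatrix_commute`). Hence G can
be defined directly as exp(∑ x_j A_j) applied to the constant vector 1. The component of G at the
identity is the plane wave, and each integral reflection acts on components by left translation
(`leftShift_solutionVec`). Therefore the component at w is `w^γ e^{iλ}`, and the choice of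
decomposition is immaterial.

On the closed alcove where w sorts x, ψ is the w-component of G at the sorted point. On the walls
the choices of w agree, because G is fixed by the stabilizer of a sorted point
(`leftShift_solutionVec_of_stabilizer`). Continuity and smoothness on alcoves follow.

Now move one coordinate, the last for b^- and the first for b^+. Off the other coordinates, ψ obeys
a first-order equation in that coordinate, whose source terms are values of ψ with the moving
coordinate exchanged with another one (`hasDerivAt_psi_insertNth`). When the moving coordinate lies
beyond all others on its own side, ψ splits off an exponential factor. Variation of constants turns
this into an integral equation (`psi_snoc`, `psi_cons`). Peeling one index off each tuple shows that
b^± applied to the smaller wavefunction solves the same equation (`bMinus_snoc`, `bPlus_cons`). The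
solution is unique, since each exchange lowers the number of coordinates on the wrong side of the
moving one (`eq_of_snoc_equation`, `eq_of_cons_equation`). Iteration gives the product formulas. -/

/-! ### Linear operators on functions of a permutation -/

/-- The sign with which the transposition of `j` and `m` enters the `j`-th Dunkl-type operator at
the permutation `w`. -/
def dunklSign {N : ℕ} (w : Equiv.Perm (Fin N)) (j m : Fin N) : ℝ :=
  (if j < m ∧ w⁻¹ m < w⁻¹ j then 1 else 0) - (if m < j ∧ w⁻¹ j < w⁻¹ m then 1 else 0)

/-- The space of complex functions of a permutation. -/
def PermSpace (N : ℕ) : Type := Equiv.Perm (Fin N) → ℂ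

instance (N : ℕ) : NormedAddCommGroup (PermSpace N) :=
  inferInstanceAs (NormedAddCommGroup (Equiv.Perm (Fin N) → ℂ))

instance (N : ℕ) : NormedSpace ℝ (PermSpace N) :=
  inferInstanceAs (NormedSpace ℝ (Equiv.Perm (Fin N) → ℂ))

instance (N : ℕ) : CompleteSpace (PermSpace N) :=
  inferInstanceAs (CompleteSpace (Equiv.Perm (Fin N) → ℂ))

/-- Evaluation at a permutation. -/
def evalAt {N : ℕ} (w : Equiv.Perm (Fin N)) : PermSpace N →L[ℝ] ℂ :=
  (ContinuousLinearMap.proj w : (Equiv.Perm (Fin N) → ℂ) →L[ℝ] ℂ)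

theorem PermSpace.ext {N : ℕ} {v v' : PermSpace N} (h : ∀ w, evalAt w v = evalAt w v') :
    v = v' := funext h

/-- The matrix of the partial derivative `∂_j` in the linear system satisfied by the vector
`(w^γ e^{iλ})_w`. -/
def dunklMatrix (γ : ℝ) {N : ℕ} (lam : Fin N → ℂ) (j : Fin N) : PermSpace N →L[ℝ] PermSpace N where
  toFun v := fun w => Complex.I * lam (w⁻¹ j) * evalAt w v +
      ∑ m, ((γ * dunklSign w j m : ℝ) : ℂ) * evalAt (Equiv.swap j m * w) v
  map_add' v v' := by
    refine funext fun w => ?_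
    change _ = (_ + _ : ℂ)
    simp only [map_add, mul_add, Finset.sum_add_distrib]
    ring
  map_smul' c v := by
    refine funext fun w => ?_
    change _ = c • (_ : ℂ)
    simp only [map_smul, Complex.real_smul, mul_add, Finset.mul_sum]
    congr 1
    · ring
    · exact Finset.sum_congr rfl fun m _ => by ring
  cont := continuous_pi fun w => by fun_prop

theorem evalAt_dunklMatrix (γ : ℝ) {N : ℕ} (lam : Fin N → ℂ) (j : Fin N)
    (v : PermSpace N) (w : Equiv.Perm (Fin N)) :
    evalAt w (dunklMatrix γ lam j v) = Complex.I * lam (w⁻¹ j) * evalAt w v +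
      ∑ m, ((γ * dunklSign w j m : ℝ) : ℂ) * evalAt (Equiv.swap j m * w) v := rfl

/-- Left translation by a permutation. -/
def leftShift {N : ℕ} (u : Equiv.Perm (Fin N)) : PermSpace N →L[ℝ] PermSpace N where
  toFun v := fun w => evalAt (u * w) v
  map_add' v v' := PermSpace.ext fun w => map_add (evalAt (u * w)) v v'
  map_smul' c v := PermSpace.ext fun w => map_smul (evalAt (u * w)) c v
  cont := continuous_pi fun w => by fun_prop

@[simp]
theorem evalAt_leftShift {N : ℕ} (u : Equiv.Perm (Fin N)) (v : PermSpace N)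
    (w : Equiv.Perm (Fin N)) : evalAt w (leftShift u v) = evalAt (u * w) v := rfl

theorem leftShift_mul {N : ℕ} (u u' : Equiv.Perm (Fin N)) :
    leftShift u * leftShift u' = leftShift (u' * u) := by
  ext v : 1
  refine PermSpace.ext fun w => ?_
  simp [mul_assoc]

theorem lowIdx_lt_highIdx {N : ℕ} (a : Fin (N - 1)) : lowIdx a < highIdx a := by
  simp [lowIdx, highIdx, Fin.lt_def]

theorem simpleTransposition_mul_self {N : ℕ} (a : Fin (N - 1)) :
    simpleTransposition a * simpleTransposition a = 1 := Equiv.swap_mul_self _ _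

@[simp]
theorem simpleTransposition_inv {N : ℕ} (a : Fin (N - 1)) :
    (simpleTransposition a)⁻¹ = simpleTransposition a := Equiv.swap_inv _ _

@[simp]
theorem simpleTransposition_lowIdx {N : ℕ} (a : Fin (N - 1)) :
    simpleTransposition a (lowIdx a) = highIdx a := Equiv.swap_apply_left _ _

@[simp]
theorem simpleTransposition_highIdx {N : ℕ} (a : Fin (N - 1)) :
    simpleTransposition a (highIdx a) = lowIdx a := Equiv.swap_apply_right _ _

theorem simpleTransposition_lt_iff {N : ℕ} (a : Fin (N - 1)) {j m : Fin N}
    (h : ¬(j = lowIdx a ∧ m = highIdx a)) (h' : ¬(j = highIdx a ∧ m = lowIdx a)) :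
    simpleTransposition a j < simpleTransposition a m ↔ j < m := by
  unfold simpleTransposition
  rw [Equiv.swap_apply_def, Equiv.swap_apply_def]
  simp only [lowIdx, highIdx, Fin.ext_iff, Fin.lt_def] at *
  split_ifs <;> simp only at * <;> omega

/-- The scalar in the commutation relation between the matrices of `∂_j` and `s_a^γ`. -/
def crossSign {N : ℕ} (a : Fin (N - 1)) (j : Fin N) : ℝ :=
  (if j = highIdx a then 1 else 0) - (if j = lowIdx a then 1 else 0)

/-- A simple transposition preserves the order of every pair of indices except the pair it
exchanges. The signs at w and at its translate thus differ only for that pair, and there the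
permutation of the summand collapses to w, which produces the scalar correction. -/
theorem dunklSign_simpleTransposition {N : ℕ} (a : Fin (N - 1)) (w : Equiv.Perm (Fin N))
    (j m : Fin N) (v : PermSpace N) :
    ((dunklSign w (simpleTransposition a j) (simpleTransposition a m) : ℝ) : ℂ) *
        evalAt (Equiv.swap j m * simpleTransposition a * w) v =
      ((dunklSign (simpleTransposition a * w) j m : ℝ) : ℂ) *
        evalAt (Equiv.swap j m * simpleTransposition a * w) v +
      if m = simpleTransposition a j then ((crossSign a j : ℝ) : ℂ) * evalAt w v else 0 := by
  have hlt := lowIdx_lt_highIdx a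
  by_cases h : j = lowIdx a ∧ m = highIdx a
  · obtain ⟨rfl, rfl⟩ := h
    have hs : Equiv.swap (lowIdx a) (highIdx a) * simpleTransposition a = 1 :=
      simpleTransposition_mul_self a
    have hne : w⁻¹ (lowIdx a) ≠ w⁻¹ (highIdx a) := fun e => hlt.ne (w⁻¹.injective e)
    rw [hs]
    simp only [dunklSign, crossSign, simpleTransposition_lowIdx, simpleTransposition_highIdx,
      mul_inv_rev, simpleTransposition_inv, Equiv.Perm.mul_apply]
    generalize w⁻¹ (lowIdx a) = p at hne ⊢
    generalize w⁻¹ (highIdx a) = q at hne ⊢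
    rcases lt_or_gt_of_ne hne with h1 | h1 <;>
    simp [hlt, hlt.not_gt, hlt.ne, h1, h1.not_gt]
  by_cases h' : j = highIdx a ∧ m = lowIdx a
  · obtain ⟨rfl, rfl⟩ := h'
    have hs : Equiv.swap (highIdx a) (lowIdx a) * simpleTransposition a = 1 := by
      rw [Equiv.swap_comm]; exact simpleTransposition_mul_self a
    have hne : w⁻¹ (lowIdx a) ≠ w⁻¹ (highIdx a) := fun e => hlt.ne (w⁻¹.injective e)
    rw [hs]
    simp only [dunklSign, crossSign, simpleTransposition_lowIdx, simpleTransposition_highIdx,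
      mul_inv_rev, simpleTransposition_inv, Equiv.Perm.mul_apply]
    generalize w⁻¹ (lowIdx a) = p at hne ⊢
    generalize w⁻¹ (highIdx a) = q at hne ⊢
    rcases lt_or_gt_of_ne hne with h1 | h1 <;>
    simp [hlt, hlt.not_gt, hlt.ne', h1, h1.not_gt]
  have h1 : dunklSign w (simpleTransposition a j) (simpleTransposition a m) =
      dunklSign (simpleTransposition a * w) j m := by
    unfold dunklSign
    simp [simpleTransposition_lt_iff a h h',
      simpleTransposition_lt_iff a (fun e => h' e.symm) (fun e => h e.symm)]
  rw [h1, left_eq_add, ite_eq_right_iff]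
  rintro rfl
  have hl : j ≠ lowIdx a := by rintro rfl; simp at h
  have hh : j ≠ highIdx a := by rintro rfl; simp at h'
  simp [crossSign, hl, hh]

/-- The cross relation of the degenerate affine Hecke algebra. The diagonal parts intertwine
exactly, and the scalar term is the single correction from `dunklSign_simpleTransposition`. -/
theorem dunklMatrix_mul_leftShift (γ : ℝ) {N : ℕ} (lam : Fin N → ℂ) (a : Fin (N - 1))
    (j : Fin N) :
    dunklMatrix γ lam (simpleTransposition a j) * leftShift (simpleTransposition a) =
      leftShift (simpleTransposition a) * dunklMatrix γ lam j + (γ * crossSign a j) • 1 := by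
  ext v : 1
  refine PermSpace.ext fun w => ?_
  have hswap : ∀ m, simpleTransposition a *
      (Equiv.swap (simpleTransposition a j) (simpleTransposition a m) * w) =
      Equiv.swap j m * simpleTransposition a * w := by
    intro m
    rw [Equiv.swap_apply_apply]
    simp [← mul_assoc, simpleTransposition_mul_self]
  simp only [mul_apply_eq_comp, add_apply, map_add, map_smul,
    evalAt_leftShift, evalAt_dunklMatrix, smul_apply,
    one_apply_eq_self, Complex.real_smul]
  rw [← Equiv.sum_comp (simpleTransposition a)]
  simp only [hswap, Complex.ofReal_mul, mul_assoc (γ : ℂ)]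
  simp only [dunklSign_simpleTransposition, mul_add, Finset.sum_add_distrib, mul_ite, mul_zero,
    Finset.sum_ite_eq', Finset.mem_univ, if_true]
  simp [mul_assoc, add_assoc]

/-- The identity has no inversions, so its row is diagonal. This starts the induction for
commutativity and makes the identity component of the solution a plane wave. -/
theorem evalAt_one_dunklMatrix (γ : ℝ) {N : ℕ} (lam : Fin N → ℂ) (j : Fin N)
    (v : PermSpace N) :
    evalAt 1 (dunklMatrix γ lam j v) = Complex.I * lam j * evalAt 1 v := by
  rw [evalAt_dunklMatrix, Finset.sum_eq_zero]
  · simp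
  · intro m _
    have : dunklSign 1 j m = 0 := by
      unfold dunklSign
      simp only [inv_one, Equiv.Perm.one_apply]
      rw [if_neg (fun h => lt_asymm h.1 h.2), if_neg (fun h => lt_asymm h.1 h.2), sub_zero]
    simp [this]

theorem crossSign_smul_sub (γ : ℝ) {N : ℕ} (lam : Fin N → ℂ) (a : Fin (N - 1)) (j : Fin N) :
    dunklMatrix γ lam (simpleTransposition a j) - dunklMatrix γ lam j =
      crossSign a j • (dunklMatrix γ lam (lowIdx a) - dunklMatrix γ lam (highIdx a)) := by
  have hlt := lowIdx_lt_highIdx a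
  by_cases h : j = lowIdx a
  · subst h; simp [crossSign, hlt.ne]
  by_cases h' : j = highIdx a
  · subst h'; simp [crossSign, hlt.ne']
  have : simpleTransposition a j = j := Equiv.swap_apply_of_ne_of_ne h h'
  simp [crossSign, h, h', this]

/-- The remainder from using the cross relation twice becomes symmetric in j and k once
`crossSign_smul_sub` rewrites the reflected matrices, so it cancels in the commutator. -/
theorem commutator_mul_leftShift (γ : ℝ) {N : ℕ} (lam : Fin N → ℂ) (a : Fin (N - 1))
    (j k : Fin N) :
    (dunklMatrix γ lam (simpleTransposition a j) * dunklMatrix γ lam (simpleTransposition a k) -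
      dunklMatrix γ lam (simpleTransposition a k) * dunklMatrix γ lam (simpleTransposition a j)) *
        leftShift (simpleTransposition a) =
      leftShift (simpleTransposition a) *
        (dunklMatrix γ lam j * dunklMatrix γ lam k - dunklMatrix γ lam k * dunklMatrix γ lam j) := by
  have key : ∀ j k : Fin N,
      dunklMatrix γ lam (simpleTransposition a j) * dunklMatrix γ lam (simpleTransposition a k) *
        leftShift (simpleTransposition a) =
      leftShift (simpleTransposition a) * (dunklMatrix γ lam j * dunklMatrix γ lam k) +
        γ • (crossSign a j • dunklMatrix γ lam k +
          crossSign a k • dunklMatrix γ lam (simpleTransposition a j)) := by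
    intro j k
    rw [mul_assoc, dunklMatrix_mul_leftShift, mul_add, ← mul_assoc, dunklMatrix_mul_leftShift,
      add_mul, mul_assoc, smul_mul_assoc, one_mul, mul_smul_comm, mul_one, smul_add, smul_smul,
      smul_smul, add_assoc]
  rw [sub_mul, key, key, mul_sub]
  have h1 : dunklMatrix γ lam (simpleTransposition a j) = dunklMatrix γ lam j +
      crossSign a j • (dunklMatrix γ lam (lowIdx a) - dunklMatrix γ lam (highIdx a)) := by
    rw [← crossSign_smul_sub]; abel
  have h2 : dunklMatrix γ lam (simpleTransposition a k) = dunklMatrix γ lam k +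
      crossSign a k • (dunklMatrix γ lam (lowIdx a) - dunklMatrix γ lam (highIdx a)) := by
    rw [← crossSign_smul_sub]; abel
  rw [h1, h2]
  module

/-- The identity row of every commutator vanishes, and `commutator_mul_leftShift` carries this to
the row of any word, one letter at a time. The induction needs all j and k at once, because each
letter permutes the indices. -/
theorem dunklMatrix_commute (γ : ℝ) {N : ℕ} (lam : Fin N → ℂ) (j k : Fin N) :
    Commute (dunklMatrix γ lam j) (dunklMatrix γ lam k) := by
  have key : ∀ (l : List (Fin (N - 1))) (j k : Fin N) (v : PermSpace N),
      evalAt (l.map simpleTransposition).prod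
        ((dunklMatrix γ lam j * dunklMatrix γ lam k -
          dunklMatrix γ lam k * dunklMatrix γ lam j) v) = 0 := by
    intro l
    induction l with
    | nil =>
      intro j k v
      simp only [List.map_nil, List.prod_nil, sub_apply, map_sub,
        mul_apply_eq_comp, evalAt_one_dunklMatrix]
      ring
    | cons a l ih =>
      intro j k v
      rw [List.map_cons, List.prod_cons, ← evalAt_leftShift, ← mul_apply_eq_comp,
        ← commutator_mul_leftShift, mul_apply_eq_comp]
      exact ih _ _ _
  refine sub_eq_zero.mp ?_
  ext v : 1
  refine PermSpace.ext fun w => ?_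
  obtain ⟨l, rfl⟩ := exists_word w
  exact key l j k v

/-! ### The fundamental solution of the linear system -/

theorem eq_zero_of_hasDerivAt_clm {E : Type*} [NormedAddCommGroup E] [NormedSpace ℝ E]
    {f : ℝ → E} {M : E →L[ℝ] E} (h : ∀ t, HasDerivAt f (M (f t)) t) (h0 : f 0 = 0) (t : ℝ) :
    f t = 0 := by
  have : f = fun _ => 0 := by
    refine ODE_solution_unique_univ (v := fun _ y => M y) (s := fun _ => Set.univ) (K := ‖M‖₊)
      (t₀ := 0) (fun t => M.lipschitz.lipschitzOnWith) (fun t => ⟨h t, trivial⟩)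
      (fun t => ⟨?_, trivial⟩) h0
    simpa using hasDerivAt_const t (0 : E)
  exact congrFun this t

/-- The directional derivative matrix `∑_j x_j A_j`. -/
def dunklSum (γ : ℝ) {N : ℕ} (lam : Fin N → ℂ) (x : Fin N → ℝ) : PermSpace N →L[ℝ] PermSpace N :=
  ∑ j, x j • dunklMatrix γ lam j

/-- The constant vector `1`. -/
def oneVec (N : ℕ) : PermSpace N := fun _ => (1 : ℂ)

@[simp]
theorem evalAt_oneVec {N : ℕ} (w : Equiv.Perm (Fin N)) : evalAt w (oneVec N) = 1 := rfl

@[simp]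
theorem leftShift_oneVec {N : ℕ} (u : Equiv.Perm (Fin N)) :
    leftShift u (oneVec N) = oneVec N := rfl

/-- The solution of the linear system with constant initial value `1` at the origin. -/
def solutionVec (γ : ℝ) {N : ℕ} (lam : Fin N → ℂ) (x : Fin N → ℝ) : PermSpace N :=
  NormedSpace.exp (dunklSum γ lam x) (oneVec N)

theorem dunklSum_add (γ : ℝ) {N : ℕ} (lam : Fin N → ℂ) (x y : Fin N → ℝ) :
    dunklSum γ lam (x + y) = dunklSum γ lam x + dunklSum γ lam y := by
  simp [dunklSum, add_smul, Finset.sum_add_distrib]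

theorem dunklSum_smul (γ : ℝ) {N : ℕ} (lam : Fin N → ℂ) (c : ℝ) (x : Fin N → ℝ) :
    dunklSum γ lam (c • x) = c • dunklSum γ lam x := by
  simp [dunklSum, Finset.smul_sum, smul_smul]

theorem dunklSum_single (γ : ℝ) {N : ℕ} (lam : Fin N → ℂ) (j : Fin N) :
    dunklSum γ lam (Pi.single j 1) = dunklMatrix γ lam j := by
  unfold dunklSum
  rw [Finset.sum_eq_single j]
  · simp
  · intro k _ hk; simp [hk]
  · simp

theorem dunklSum_commute (γ : ℝ) {N : ℕ} (lam : Fin N → ℂ) (x y : Fin N → ℝ) :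
    Commute (dunklSum γ lam x) (dunklSum γ lam y) :=
  Commute.sum_left _ _ _ fun j _ => Commute.sum_right _ _ _ fun k _ =>
    ((dunklMatrix_commute γ lam j k).smul_left _).smul_right _

theorem dunklSum_mul_leftShift (γ : ℝ) {N : ℕ} (lam : Fin N → ℂ) (a : Fin (N - 1))
    (x : Fin N → ℝ) :
    dunklSum γ lam x * leftShift (simpleTransposition a) =
      leftShift (simpleTransposition a) * dunklSum γ lam (permAct (simpleTransposition a) x) +
        (γ * (x (lowIdx a) - x (highIdx a))) • 1 := by
  have h : ∑ j, x (simpleTransposition a j) * crossSign a j = x (lowIdx a) - x (highIdx a) := by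
    simp [crossSign, mul_sub, Finset.sum_sub_distrib]
  unfold dunklSum
  rw [← Equiv.sum_comp (simpleTransposition a), Finset.sum_mul, Finset.mul_sum]
  simp only [smul_mul_assoc, dunklMatrix_mul_leftShift, permAct, simpleTransposition_inv,
    smul_add, Finset.sum_add_distrib, mul_smul_comm, smul_smul]
  rw [← Finset.sum_smul, ← h, Finset.mul_sum]
  congr 2
  exact Finset.sum_congr rfl fun j _ => by ring

theorem hasDerivAt_solutionVec (γ : ℝ) {N : ℕ} (lam : Fin N → ℂ) (x y : Fin N → ℝ) (u : ℝ) :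
    HasDerivAt (fun u : ℝ => solutionVec γ lam (x + u • y))
      (dunklSum γ lam y (solutionVec γ lam (x + u • y))) u := by
  have key : ∀ u : ℝ, solutionVec γ lam (x + u • y) =
      NormedSpace.exp (u • dunklSum γ lam y) (solutionVec γ lam x) := by
    intro u
    let := NormedAlgebra.restrictScalars ℚ ℝ (PermSpace N →L[ℝ] PermSpace N)
    unfold solutionVec
    rw [dunklSum_add, add_comm, NormedSpace.exp_add_of_commute (dunklSum_commute γ lam _ _),
      dunklSum_smul, mul_apply_eq_comp]
  simp only [key]
  have h := hasDerivAt_exp_smul_const' (𝕂 := ℝ) (dunklSum γ lam y) u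
  simpa using h.clm_apply (hasDerivAt_const u (solutionVec γ lam x))

theorem contDiff_solutionVec (γ : ℝ) {N : ℕ} (lam : Fin N → ℂ) :
    ContDiff ℝ ∞ (solutionVec γ lam) := by
  have h1 : ContDiff ℝ ∞ (NormedSpace.exp : (PermSpace N →L[ℝ] PermSpace N) → _) :=
    contDiff_iff_contDiffAt.mpr fun x => (NormedSpace.exp_analytic (𝕂 := ℝ) x).contDiffAt
  have h2 : ContDiff ℝ ∞ (dunklSum γ lam) := by
    unfold dunklSum
    exact ContDiff.sum fun j _ => (contDiff_apply ℝ ℝ j).smul contDiff_const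
  exact (h1.comp h2).clm_apply contDiff_const

theorem contDiff_evalAt_solutionVec (γ : ℝ) {N : ℕ} (lam : Fin N → ℂ) (w : Equiv.Perm (Fin N)) :
    ContDiff ℝ ∞ fun x => evalAt w (solutionVec γ lam x) :=
  (evalAt w).contDiff.comp (contDiff_solutionVec γ lam)

theorem continuous_solutionVec (γ : ℝ) {N : ℕ} (lam : Fin N → ℂ) :
    Continuous (solutionVec γ lam) := (contDiff_solutionVec γ lam).continuous

theorem solutionVec_zero (γ : ℝ) {N : ℕ} (lam : Fin N → ℂ) :
    solutionVec γ lam 0 = oneVec N := by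
  simp [solutionVec, dunklSum]

/-! ### Integral reflections act by left translation -/

/-- On the wall the scalar in the cross relation vanishes, so the translation commutes with the
exponential; it also fixes the vector 1. -/
theorem leftShift_solutionVec_of_eq (γ : ℝ) {N : ℕ} (lam : Fin N → ℂ) (a : Fin (N - 1))
    {x : Fin N → ℝ} (hx : x (lowIdx a) = x (highIdx a)) :
    leftShift (simpleTransposition a) (solutionVec γ lam x) = solutionVec γ lam x := by
  have hs : permAct (simpleTransposition a) x = x := by
    funext j
    rw [permAct, simpleTransposition_inv, simpleTransposition, Equiv.swap_apply_def]
    split_ifs with h1 h2 <;> simp_all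
  have hc : Commute (dunklSum γ lam x) (leftShift (simpleTransposition a)) := by
    have := dunklSum_mul_leftShift γ lam a x
    rwa [hs, hx, sub_self, mul_zero, zero_smul, add_zero] at this
  unfold solutionVec
  rw [← mul_apply_eq_comp, ← (hc.exp_left).eq, mul_apply_eq_comp, leftShift_oneVec]

theorem leftShift_solutionVec (γ : ℝ) {N : ℕ} (lam : Fin N → ℂ) (a : Fin (N - 1))
    (x : Fin N → ℝ) :
    leftShift (simpleTransposition a) (solutionVec γ lam x) =
      solutionVec γ lam (permAct (simpleTransposition a) x) +
        γ • ∫ y in (0 : ℝ)..(x (lowIdx a) - x (highIdx a)), solutionVec γ lam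
          (x - y • (Pi.single (lowIdx a) (1 : ℝ) - Pi.single (highIdx a) (1 : ℝ))) := by
  have hlt := lowIdx_lt_highIdx a
  set α : Fin N → ℝ := Pi.single (lowIdx a) (1 : ℝ) - Pi.single (highIdx a) (1 : ℝ) with hα
  set c := x (lowIdx a) - x (highIdx a) with hc
  -- The projection of x to the wall: x and its reflection are x₀ ± (c / 2) α, so the identity can
  -- be proved along the line x₀ + u α starting from u = 0.
  set x₀ := x - (c / 2) • α with hx₀
  set t := leftShift (simpleTransposition a) with ht
  set B := dunklSum γ lam α with hB
  have hαl : α (lowIdx a) = 1 := by simp [hα, hlt.ne]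
  have hαh : α (highIdx a) = -1 := by simp [hα, hlt.ne']
  have hαo : ∀ j, j ≠ lowIdx a → j ≠ highIdx a → α j = 0 := fun j h h' => by simp [hα, h, h']
  have hsα : permAct (simpleTransposition a) α = (-1 : ℝ) • α := by
    funext j
    rw [permAct, simpleTransposition_inv, simpleTransposition, Equiv.swap_apply_def]
    split_ifs with h1 h2
    · simp [h1, hαl, hαh]
    · simp [h2, hαl, hαh]
    · simp [hαo j h1 h2]
  have hwall : x₀ (lowIdx a) = x₀ (highIdx a) := by
    simp only [hx₀, Pi.sub_apply, Pi.smul_apply, hαl, hαh, smul_eq_mul, hc]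
    ring
  have hBt : ∀ v, B (t v) = (2 * γ) • v - t (B v) := by
    intro v
    have := congrArg (fun M => M v) (dunklSum_mul_leftShift γ lam a α)
    simp only [hsα, dunklSum_smul, hαl, hαh, mul_apply_eq_comp, add_apply, smul_apply,
      one_apply_eq_self, map_smul] at this
    rw [this]
    module
  set g : ℝ → PermSpace N := fun u => solutionVec γ lam (x₀ + u • α) with hg
  have hgd : ∀ u, HasDerivAt g (B (g u)) u := hasDerivAt_solutionVec γ lam x₀ α
  have hgc : Continuous g := continuous_iff_continuousAt.mpr fun u => (hgd u).continuousAt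
  have hint : ∀ u, B (∫ v in (-u)..u, g v) = g u - g (-u) := by
    intro u
    rw [← ContinuousLinearMap.intervalIntegral_comp_comm B (hgc.intervalIntegrable _ _)]
    exact intervalIntegral.integral_eq_sub_of_hasDerivAt (fun v _ => hgd v)
      ((B.continuous.comp hgc).intervalIntegrable _ _)
  have hneg : ∀ u, HasDerivAt (fun u => g (-u)) (-B (g (-u))) u := by
    intro u
    exact (HasDerivAt.scomp u (hgd (-u)) (hasDerivAt_neg u)).congr_deriv (by simp)
  have hH : ∀ u, HasDerivAt (fun u => ∫ v in (-u)..u, g v) (g u + g (-u)) u := by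
    intro u
    have h1 : ∀ u, HasDerivAt (fun u => ∫ v in (0 : ℝ)..u, g v) (g u) u := fun u =>
      (hgc.integral_hasStrictDerivAt 0 u).hasDerivAt
    have h2 := (h1 u).sub (HasDerivAt.scomp u (h1 (-u)) (hasDerivAt_neg u))
    refine (h2.congr_deriv (by simp)).congr_of_eventuallyEq (Filter.Eventually.of_forall fun u => ?_)
    exact (intervalIntegral.integral_interval_sub_left (hgc.intervalIntegrable _ _)
      (hgc.intervalIntegrable _ _)).symm
  -- The defect of the claimed identity satisfies D' = -B D, by `hBt` and `hint`, and D(0) = 0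
  -- because x₀ is on the wall.
  have hD : ∀ u, t (g u) - g (-u) - γ • (∫ v in (-u)..u, g v) = 0 := by
    refine eq_zero_of_hasDerivAt_clm (M := -B) (fun u => ?_) ?_
    · refine ((((t.hasFDerivAt).comp_hasDerivAt u (hgd u)).sub (hneg u)).sub
        ((hH u).const_smul γ)).congr_deriv ?_
      simp only [neg_apply, map_sub, map_smul, hint, hBt]
      module
    · simp only [hg, neg_zero, zero_smul, add_zero, intervalIntegral.integral_same, smul_zero,
        sub_zero]
      rw [ht, leftShift_solutionVec_of_eq γ lam a hwall, sub_self]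
  have h := hD (c / 2)
  have e1 : g (c / 2) = solutionVec γ lam x := by simp [hg, hx₀]
  have e2 : g (-(c / 2)) = solutionVec γ lam (permAct (simpleTransposition a) x) := by
    simp only [hg, hx₀]
    congr 1
    funext j
    rw [permAct, simpleTransposition_inv, simpleTransposition, Equiv.swap_apply_def]
    split_ifs with h1 h2
    · subst h1; simp [hαl, hc]; ring
    · subst h2; simp [hαh, hc]; ring
    · simp [hαo j h1 h2]
  have e3 : ∫ y in (0 : ℝ)..c, solutionVec γ lam (x - y • α) = ∫ v in (-(c / 2))..(c / 2), g v := by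
    have := intervalIntegral.integral_comp_sub_left (a := 0) (b := c) g (c / 2)
    rw [sub_zero, show c / 2 - c = -(c / 2) by ring] at this
    rw [← this]
    refine intervalIntegral.integral_congr fun y _ => ?_
    simp only [hg, hx₀]
    congr 1
    module
  rw [e3, ← e1, ← e2]
  rw [sub_sub, sub_eq_zero] at h
  exact h

theorem integralReflection_solutionVec (γ : ℝ) {N : ℕ} (lam : Fin N → ℂ) (a : Fin (N - 1))
    (w : Equiv.Perm (Fin N)) :
    integralReflection γ a (fun x => evalAt w (solutionVec γ lam x)) =
      fun x => evalAt (simpleTransposition a * w) (solutionVec γ lam x) := by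
  funext x
  rw [← evalAt_leftShift, leftShift_solutionVec, map_add, map_smul,
    ← ContinuousLinearMap.intervalIntegral_comp_comm]
  · simp [integralReflection, integralOp, permFun, Complex.real_smul]
  · refine Continuous.intervalIntegrable ?_ _ _
    exact (continuous_solutionVec γ lam).comp (by fun_prop)

theorem evalAt_one_solutionVec (γ : ℝ) {N : ℕ} (lam : Fin N → ℂ) (x : Fin N → ℝ) :
    evalAt 1 (solutionVec γ lam x) = planeWave lam x := by
  set c : ℂ := Complex.I * ∑ j, lam j * (x j : ℂ) with hc
  have h1 : ∀ v, evalAt 1 (dunklSum γ lam x v) = c * evalAt 1 v := by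
    intro v
    simp only [dunklSum, sum_apply, smul_apply, map_sum, map_smul, evalAt_one_dunklMatrix, hc,
      Finset.mul_sum, Finset.sum_mul, Complex.real_smul]
    exact Finset.sum_congr rfl fun j _ => by ring
  have h2 : ∀ u : ℝ, HasDerivAt (fun u : ℝ => evalAt 1 (solutionVec γ lam ((0 : Fin N → ℝ) + u • x)))
      (c * evalAt 1 (solutionVec γ lam ((0 : Fin N → ℝ) + u • x))) u := by
    intro u
    rw [← h1]
    exact (evalAt 1).hasFDerivAt.comp_hasDerivAt u (hasDerivAt_solutionVec γ lam 0 x u)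
  have h3 : ∀ u : ℝ, HasDerivAt (fun u : ℝ => Complex.exp (-(c * u))) (-c * Complex.exp (-(c * u))) u := by
    intro u
    have := ((((hasDerivAt_id (u : ℂ)).const_mul c).neg).cexp).comp_ofReal
    refine this.congr_deriv ?_
    simp [mul_comm]
  have h4 : ∀ u : ℝ, HasDerivAt (fun u : ℝ => Complex.exp (-(c * u)) *
      evalAt 1 (solutionVec γ lam ((0 : Fin N → ℝ) + u • x))) 0 u := fun u =>
    ((h3 u).mul (h2 u)).congr_deriv (by ring)
  have h5 := is_const_of_deriv_eq_zero (fun u => (h4 u).differentiableAt) (fun u => (h4 u).deriv) 1 0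
  simp only [Complex.ofReal_one, mul_one, one_smul, zero_add, Complex.ofReal_zero, mul_zero,
    neg_zero, Complex.exp_zero, zero_smul, solutionVec_zero, one_mul, Complex.exp_neg] at h5
  rw [inv_mul_eq_iff_eq_mul₀ (Complex.exp_ne_zero _)] at h5
  rw [h5, planeWave, ← hc, evalAt_oneVec, mul_one]

/-- Only the product of the word enters on the right, so on plane waves the arbitrary choice of word
in `permGamma` is harmless. -/
theorem wordOp_planeWave (γ : ℝ) {N : ℕ} (lam : Fin N → ℂ) (l : List (Fin (N - 1))) :
    wordOp γ l (planeWave lam) =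
      fun x => evalAt (l.map simpleTransposition).prod (solutionVec γ lam x) := by
  induction l with
  | nil =>
    funext x
    simp [wordOp, evalAt_one_solutionVec]
  | cons a l ih =>
    have : wordOp γ (a :: l) (planeWave lam) =
        integralReflection γ a (wordOp γ l (planeWave lam)) := rfl
    rw [this, ih, integralReflection_solutionVec, List.map_cons, List.prod_cons]

theorem permGamma_planeWave (γ : ℝ) {N : ℕ} (lam : Fin N → ℂ) (w : Equiv.Perm (Fin N)) :
    permGamma γ w (planeWave lam) = fun x => evalAt w (solutionVec γ lam x) := by
  rw [permGamma, wordOp_planeWave, (exists_word w).choose_spec]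

/-! ### The wavefunction on closed alcoves -/

@[simp]
theorem permAct_one {N : ℕ} (x : Fin N → ℝ) : permAct 1 x = x := rfl

theorem permAct_mul {N : ℕ} (u w : Equiv.Perm (Fin N)) (x : Fin N → ℝ) :
    permAct (u * w) x = permAct u (permAct w x) := by
  funext j
  simp [permAct]

theorem continuous_permAct {N : ℕ} (w : Equiv.Perm (Fin N)) : Continuous (permAct w) :=
  continuous_pi fun _ => continuous_apply _

theorem contDiff_permAct {N : ℕ} (w : Equiv.Perm (Fin N)) : ContDiff ℝ ∞ (permAct w) :=
  contDiff_pi.mpr fun _ => contDiff_apply ℝ ℝ _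

theorem permAct_eq_comp_sort {N : ℕ} {w : Equiv.Perm (Fin N)} {x : Fin N → ℝ}
    (h : Antitone (permAct w x)) : permAct w x = permAct (sortingPerm x) x := by
  have h1 : Monotone ((fun j => -x j) ∘ (w⁻¹ : Equiv.Perm (Fin N))) := fun j k hjk =>
    neg_le_neg (h hjk)
  have h2 := Tuple.comp_sort_eq_comp_iff_monotone.mpr h1
  funext j
  have h3 := congrFun h2 j
  simp only [Function.comp] at h3
  rw [permAct, permAct, sortingPerm, inv_inv]
  linarith

theorem antitone_permAct_sortingPerm {N : ℕ} (x : Fin N → ℝ) :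
    Antitone (permAct (sortingPerm x) x) := by
  intro j k hjk
  have := Tuple.monotone_sort (fun j => -x j) hjk
  simp only [Function.comp] at this
  simp only [permAct, sortingPerm, inv_inv]
  linarith

/-- Since z is sorted, all coordinates between two equal ones are equal as well. A transposition is
thus conjugated down to adjacent ones, each handled by the wall lemma; d + 1 is the distance between
i and j. -/
theorem leftShift_swap_solutionVec (γ : ℝ) {N : ℕ} (lam : Fin N → ℂ) {z : Fin N → ℝ}
    (hz : Antitone z) (d : ℕ) : ∀ i j : Fin N, (i : ℕ) + d + 1 = j → z i = z j →
    leftShift (Equiv.swap i j) (solutionVec γ lam z) = solutionVec γ lam z := by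
  have adj : ∀ i j : Fin N, (i : ℕ) + 1 = j → z i = z j →
      leftShift (Equiv.swap i j) (solutionVec γ lam z) = solutionVec γ lam z := by
    intro i j hij hzij
    have hi : lowIdx ⟨i, by omega⟩ = i := rfl
    have hj : highIdx ⟨i, by omega⟩ = j := Fin.ext hij
    have := leftShift_solutionVec_of_eq γ lam ⟨i, by omega⟩ (x := z) (by rw [hi, hj, hzij])
    rwa [simpleTransposition, hi, hj] at this
  induction d with
  | zero => exact adj
  | succ d ih =>
    intro i j hij hzij
    let k : Fin N := ⟨i + d + 1, by omega⟩
    have hik : i ≤ k := by simp only [k, Fin.le_def]; omega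
    have hkj : k ≤ j := by simp only [k, Fin.le_def]; omega
    have h1 := hz hik
    have h2 := hz hkj
    have hzik : z i = z k := by linarith
    have hzkj : z k = z j := by linarith
    have hne : i ≠ k := by simp only [k, ne_eq, Fin.ext_iff]; omega
    have hne' : i ≠ j := by simp only [ne_eq, Fin.ext_iff]; omega
    rw [Equiv.swap_comm, ← Equiv.swap_mul_swap_mul_swap hne hne', ← leftShift_mul, ← leftShift_mul]
    simp only [mul_apply_eq_comp]
    rw [adj k j (by simp only [k]; omega) hzkj, ih i k rfl hzik,
      adj k j (by simp only [k]; omega) hzkj]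

theorem leftShift_solutionVec_of_stabilizer (γ : ℝ) {N : ℕ} (lam : Fin N → ℂ) {z : Fin N → ℝ}
    (hz : Antitone z) {u : Equiv.Perm (Fin N)} (hu : ∀ j, z (u j) = z j) :
    leftShift u (solutionVec γ lam z) = solutionVec γ lam z := by
  -- Bubble sort writes u as a product of transpositions. Each one exchanges an inverted pair of a
  -- stabilizing ρ, and sortedness of z then forces the two coordinates to be equal. The motive
  -- transports invariance from the current ρ back to u; sorting ends at ρ = 1.
  have key := Tuple.bubble_sort_induction' (f := u) (P := fun g => ∃ ρ : Equiv.Perm (Fin N),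
      g = ρ ∧ (∀ j, z (ρ j) = z j) ∧
        (leftShift ρ (solutionVec γ lam z) = solutionVec γ lam z →
          leftShift u (solutionVec γ lam z) = solutionVec γ lam z)) ⟨u, rfl, hu, id⟩ (by
    rintro σ i j hij hlt ⟨ρ, hρ, hst, himp⟩
    rw [hρ] at hlt
    have h1 := hz hij.le
    have h2 := hz hlt.le
    rw [hst, hst] at h2
    have hzij : z i = z j := le_antisymm h2 h1
    refine ⟨ρ * Equiv.swap i j, ?_, fun k => ?_, fun h => himp ?_⟩
    · rw [← Function.comp_assoc, hρ]; rfl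
    · rw [Equiv.Perm.mul_apply, hst, Equiv.swap_apply_def]
      split_ifs with h3 h4 <;> simp_all
    · have hsw := leftShift_swap_solutionVec γ lam hz (j - i - 1) i j
        (by have := Fin.lt_def.mp hij; omega) hzij
      rw [← leftShift_mul, mul_apply_eq_comp] at h
      have h5 := congrArg (leftShift (Equiv.swap i j)) h
      rwa [← mul_apply_eq_comp, leftShift_mul, Equiv.swap_mul_self, hsw] at h5)
  obtain ⟨ρ, hρ, -, himp⟩ := key
  have hid : (u : Fin N → Fin N) ∘ Tuple.sort u = u ∘ (u⁻¹ : Equiv.Perm (Fin N)) :=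
    (Tuple.comp_sort_eq_comp_iff_monotone.mpr (by
      have : (u : Fin N → Fin N) ∘ (u⁻¹ : Equiv.Perm (Fin N)) = id := by funext j; simp
      rw [this]; exact monotone_id)).symm ▸ rfl
  have hρ1 : ρ = 1 := by
    ext j
    rw [← hρ, hid]
    simp
  exact himp (by rw [hρ1]; rfl)

/-- The wavefunction on the closure of the alcove `w⁻¹ ℝ^N_+`. -/
theorem psi_eq (γ : ℝ) {N : ℕ} (lam : Fin N → ℂ) {x : Fin N → ℝ} {w : Equiv.Perm (Fin N)}
    (h : Antitone (permAct w x)) :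
    psi γ lam x = evalAt w (solutionVec γ lam (permAct w x)) := by
  have h0 : psi γ lam x =
      evalAt (sortingPerm x) (solutionVec γ lam (permAct (sortingPerm x) x)) := by
    rw [psi, propagation, permGamma_planeWave, permFun, inv_inv]
  -- Two permutations sorting x differ by an element of the stabilizer of the sorted point.
  have hst : ∀ j, permAct w x ((sortingPerm x * w⁻¹) j) = permAct w x j := by
    intro j
    have h1 := congrFun (permAct_eq_comp_sort h) ((sortingPerm x * w⁻¹) j)
    rw [h1]
    simp [permAct]
  have hG := congrArg (evalAt w) (leftShift_solutionVec_of_stabilizer γ lam h hst)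
  rw [evalAt_leftShift, inv_mul_cancel_right] at hG
  rw [h0, ← permAct_eq_comp_sort h, hG]

theorem continuous_psi (γ : ℝ) {N : ℕ} (lam : Fin N → ℂ) : Continuous (psi γ lam) := by
  refine (locallyFinite_of_finite fun w : Equiv.Perm (Fin N) =>
    {x : Fin N → ℝ | Antitone (permAct w x)}).continuous ?_ ?_ ?_
  · exact Set.eq_univ_of_forall fun x =>
      Set.mem_iUnion.mpr ⟨sortingPerm x, antitone_permAct_sortingPerm x⟩
  · intro w
    have : {x : Fin N → ℝ | Antitone (permAct w x)} =
        ⋂ j, ⋂ k, ⋂ _ : j ≤ k, {x | permAct w x k ≤ permAct w x j} := by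
      ext x
      simp [Antitone]
    rw [this]
    refine isClosed_iInter fun j => isClosed_iInter fun k => isClosed_iInter fun _ => ?_
    exact isClosed_le (continuous_apply _) (continuous_apply _)
  · intro w
    have : Continuous fun x => evalAt w (solutionVec γ lam (permAct w x)) :=
      (evalAt w).continuous.comp ((continuous_solutionVec γ lam).comp (continuous_permAct w))
    exact this.continuousOn.congr fun x hx => psi_eq γ lam hx

theorem psi_mem_CBInf (γ : ℝ) {N : ℕ} (lam : Fin N → ℂ) : psi γ lam ∈ CBInf N := by
  refine ⟨continuous_psi γ lam, fun w => ?_⟩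
  have : ContDiff ℝ ∞ fun x => evalAt w⁻¹ (solutionVec γ lam (permAct w⁻¹ x)) :=
    (contDiff_evalAt_solutionVec γ lam w⁻¹).comp (contDiff_permAct w⁻¹)
  refine this.contDiffOn.congr ?_
  rintro x ⟨z, hz, rfl⟩
  refine psi_eq γ lam ?_
  rw [← permAct_mul, inv_mul_cancel, permAct_one]
  exact StrictAnti.antitone fun j k hjk => hz j k hjk

/-! ### Variation of constants -/

theorem hasDerivAt_integral_max {f : ℝ → ℂ} (hf : Continuous f) {a t : ℝ} (h : a ≠ t) :
    HasDerivAt (fun t => ∫ s in a..max a t, f s) (if a < t then f t else 0) t := by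
  rcases lt_or_gt_of_ne h with h | h
  · rw [if_pos h]
    refine (hf.integral_hasStrictDerivAt a t).hasDerivAt.congr_of_eventuallyEq ?_
    filter_upwards [lt_mem_nhds h] with s hs
    rw [max_eq_right hs.le]
  · rw [if_neg h.not_gt]
    refine (hasDerivAt_const t (0 : ℂ)).congr_of_eventuallyEq ?_
    filter_upwards [gt_mem_nhds h] with s hs
    rw [max_eq_left hs.le, intervalIntegral.integral_same]

theorem continuous_integral_max {f : ℝ → ℂ} (hf : Continuous f) (a : ℝ) :
    Continuous fun t => ∫ s in a..max a t, f s :=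
  (intervalIntegral.continuous_primitive (fun _ _ => hf.intervalIntegrable _ _) a).comp
    (continuous_const.max continuous_id)

theorem hasDerivAt_cexp_mul (c : ℂ) (t : ℝ) :
    HasDerivAt (fun t : ℝ => Complex.exp (c * t)) (c * Complex.exp (c * t)) t := by
  have := (((hasDerivAt_id (t : ℂ)).const_mul c).cexp).comp_ofReal
  exact this.congr_deriv (by simp [mul_comm])

/-- After removing the integrals and multiplying by exp(-ct), a continuous function remains whose
derivative vanishes off the finite set of the a k. It is therefore constant, and `hC` gives its
value far to the left. -/
theorem variation_of_constants_right {ι : Type*} [Fintype ι] {φ : ℝ → ℂ} {h : ι → ℝ → ℂ}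
    {a : ι → ℝ} {c C g : ℂ} (hφ : Continuous φ) (hh : ∀ k, Continuous (h k))
    (hd : ∀ t, (∀ k, a k ≠ t) →
      HasDerivAt φ (c * φ t + g * ∑ k, if a k < t then h k t else 0) t)
    (hC : ∀ t, (∀ k, t ≤ a k) → φ t = Complex.exp (c * t) * C) (t : ℝ) :
    φ t = Complex.exp (c * t) * C +
      g * ∑ k, ∫ s in (a k)..max (a k) t, Complex.exp (c * (t - s)) * h k s := by
  have hec : Continuous fun t : ℝ => Complex.exp (-c * t) := by fun_prop
  set E : ℝ → ℂ := fun t => Complex.exp (-c * t) * φ t -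
    g * ∑ k, ∫ s in (a k)..max (a k) t, Complex.exp (-c * s) * h k s with hE
  have hEc : Continuous E := (hec.mul hφ).sub (continuous_const.mul
    (continuous_finsetSum _ fun k _ => continuous_integral_max (hec.mul (hh k)) (a k)))
  have hEd : ∀ t, (∀ k, a k ≠ t) → HasDerivAt E 0 t := by
    intro t ht
    refine (((hasDerivAt_cexp_mul (-c) t).mul (hd t ht)).sub ((HasDerivAt.fun_sum fun k _ =>
      hasDerivAt_integral_max (hec.mul (hh k)) (ht k)).const_mul g)).congr_deriv ?_
    have : ∀ k, (if a k < t then ((fun t : ℝ => Complex.exp (-c * t)) * h k) t else 0) =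
        Complex.exp (-c * t) * if a k < t then h k t else 0 := fun k => by split_ifs <;> simp
    rw [Finset.sum_congr rfl fun k _ => this k, ← Finset.mul_sum]
    ring
  have hconst : ∀ t₀ t, E t₀ = E t := by
    intro t₀ t
    have := MeasureTheory.integral_eq_of_hasDerivAt_off_countable E (fun _ => 0) (a := t₀) (b := t)
      (Set.finite_range a).countable hEc.continuousOn
      (fun x hx => hEd x fun k hk => hx.2 ⟨k, hk⟩) (by simp)
    rw [intervalIntegral.integral_zero] at this
    exact (sub_eq_zero.mp this.symm).symm
  -- An explicit base point to the left of every a k, where all integrals are empty.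
  have ht₀ : ∀ k, -∑ k, |a k| ≤ a k := by
    intro k
    have h1 := Finset.single_le_sum (f := fun k => |a k|) (fun i _ => abs_nonneg (a i))
      (Finset.mem_univ k)
    have h2 := neg_abs_le (a k)
    linarith
  have hC' := hconst (-∑ k, |a k|) t
  simp only [hE, hC _ ht₀, max_eq_left (ht₀ _), intervalIntegral.integral_same,
    Finset.sum_const_zero, mul_zero, sub_zero, ← mul_assoc, ← Complex.exp_add, neg_mul,
    neg_add_cancel, Complex.exp_zero, one_mul] at hC'
  have h3 : φ t = Complex.exp (c * t) * (Complex.exp (-(c * t)) * φ t) := by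
    rw [← mul_assoc, ← Complex.exp_add, add_neg_cancel, Complex.exp_zero, one_mul]
  have h4 : ∀ k, ∫ s in (a k)..max (a k) t, Complex.exp (c * (t - s)) * h k s =
      Complex.exp (c * t) * ∫ s in (a k)..max (a k) t, Complex.exp (-(c * s)) * h k s := by
    intro k
    rw [← intervalIntegral.integral_const_mul]
    refine intervalIntegral.integral_congr fun s _ => ?_
    rw [← mul_assoc, ← Complex.exp_add]
    ring_nf
  simp only [h4, ← Finset.mul_sum]
  rw [h3, hC']
  ring

theorem variation_of_constants_left {ι : Type*} [Fintype ι] {φ : ℝ → ℂ} {h : ι → ℝ → ℂ}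
    {a : ι → ℝ} {c C g : ℂ} (hφ : Continuous φ) (hh : ∀ k, Continuous (h k))
    (hd : ∀ t, (∀ k, a k ≠ t) →
      HasDerivAt φ (c * φ t - g * ∑ k, if t < a k then h k t else 0) t)
    (hC : ∀ t, (∀ k, a k ≤ t) → φ t = Complex.exp (c * t) * C) (t : ℝ) :
    φ t = Complex.exp (c * t) * C +
      g * ∑ k, ∫ s in (min (a k) t)..(a k), Complex.exp (c * (t - s)) * h k s := by
  have := variation_of_constants_right (φ := fun t => φ (-t)) (h := fun k t => h k (-t))
    (a := fun k => -a k) (c := -c) (C := C) (g := g) (hφ.comp continuous_neg)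
    (fun k => (hh k).comp continuous_neg) (fun t ht => ?_) (fun t ht => ?_) (-t)
  · simp only [neg_neg] at this
    rw [this]
    congr 1
    · simp
    · congr 1
      refine Finset.sum_congr rfl fun k _ => ?_
      have h1 := intervalIntegral.integral_comp_neg (a := -a k) (b := max (-a k) (-t))
        (fun s => Complex.exp (c * (t - s)) * h k s)
      rw [max_neg_neg, neg_neg, neg_neg] at h1
      rw [max_neg_neg, ← h1]
      refine intervalIntegral.integral_congr fun s _ => ?_
      congr 2
      push_cast
      ring
  · refine (HasDerivAt.scomp t (hd (-t) fun k hk => ht k (by rw [hk, neg_neg]))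
      (hasDerivAt_neg t)).congr_deriv ?_
    simp only [neg_smul, one_smul, neg_lt]
    ring
  · have := hC (-t) fun k => by have := ht k; linarith
    simp only [this]
    simp

theorem perm_inv_apply_self {α : Type*} (w : Equiv.Perm α) (j : α) : w⁻¹ (w j) = j :=
  w.symm_apply_apply j

/-! ### Motion of a single coordinate -/

theorem permAct_insertNth_add {N : ℕ} (w : Equiv.Perm (Fin (N + 1))) (p : Fin (N + 1))
    (x : Fin N → ℝ) (t s : ℝ) :
    permAct w (p.insertNth (α := fun _ => ℝ) s x) =
      permAct w (p.insertNth (α := fun _ => ℝ) t x) +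
        (s - t) • (Pi.single (w p) 1 : Fin (N + 1) → ℝ) := by
  funext j
  obtain ⟨j, rfl⟩ := w.surjective j
  simp only [permAct, Pi.add_apply, Pi.smul_apply, perm_inv_apply_self]
  rcases eq_or_ne j p with rfl | hj
  · simp
  · obtain ⟨k, rfl⟩ := Fin.exists_succAbove_eq hj
    simp

theorem permAct_swap_insertNth {N : ℕ} (p : Fin (N + 1)) (x : Fin N → ℝ) (t : ℝ) (k : Fin N) :
    permAct (Equiv.swap p (p.succAbove k)) (p.insertNth (α := fun _ => ℝ) t x) =
      p.insertNth (α := fun _ => ℝ) (x k) (Function.update x k t) := by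
  funext j
  rw [permAct, Equiv.swap_inv]
  rcases eq_or_ne j p with rfl | hj
  · simp
  · obtain ⟨i, rfl⟩ := Fin.exists_succAbove_eq hj
    rcases eq_or_ne i k with rfl | hi
    · simp
    · rw [Equiv.swap_apply_of_ne_of_ne (Fin.succAbove_ne _ _) (by simpa using hi)]
      simp [hi]

/-- Only comparisons with the moving coordinate change, and these are strict at t. Ties among the
other coordinates are harmless because the order is weak. -/
theorem eventually_antitone_permAct_insertNth {N : ℕ} {w : Equiv.Perm (Fin (N + 1))}
    {p : Fin (N + 1)} {x : Fin N → ℝ} {t : ℝ} (ht : ∀ k, x k ≠ t)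
    (hw : Antitone (permAct w (p.insertNth (α := fun _ => ℝ) t x))) :
    ∀ᶠ s in nhds t, Antitone (permAct w (p.insertNth (α := fun _ => ℝ) s x)) := by
  have key : ∀ j k : Fin (N + 1), ∀ᶠ s in nhds t, w j ≤ w k →
      p.insertNth (α := fun _ => ℝ) s x k ≤ p.insertNth (α := fun _ => ℝ) s x j := by
    intro j k
    by_cases hjk : w j ≤ w k
    swap
    · exact Filter.Eventually.of_forall fun s h => absurd h hjk
    have h0 := hw hjk
    simp only [permAct, perm_inv_apply_self] at h0
    rcases eq_or_ne j p with hj | hj <;> rcases eq_or_ne k p with hk | hk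
    · subst hj; subst hk; simp
    · subst hj
      obtain ⟨k, rfl⟩ := Fin.exists_succAbove_eq hk
      simp only [Fin.insertNth_apply_same, Fin.insertNth_apply_succAbove] at h0 ⊢
      filter_upwards [lt_mem_nhds (lt_of_le_of_ne h0 (ht k))] with s hs _
      exact hs.le
    · subst hk
      obtain ⟨j, rfl⟩ := Fin.exists_succAbove_eq hj
      simp only [Fin.insertNth_apply_same, Fin.insertNth_apply_succAbove] at h0 ⊢
      filter_upwards [gt_mem_nhds (lt_of_le_of_ne h0 (ht j).symm)] with s hs _
      exact hs.le
    · obtain ⟨j, rfl⟩ := Fin.exists_succAbove_eq hj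
      obtain ⟨k, rfl⟩ := Fin.exists_succAbove_eq hk
      simp only [Fin.insertNth_apply_succAbove] at h0 ⊢
      exact Filter.Eventually.of_forall fun s _ => h0
  filter_upwards [Filter.eventually_all.mpr fun j => Filter.eventually_all.mpr fun k => key j k]
    with s hs i j hij
  exact hs (w⁻¹ i) (w⁻¹ j) (by simpa using hij)

/-- Near t one w sorts the whole point, so the derivative is the w-row of the matrix with index w p.
Its off-diagonal entries sit at w (p k), which sorts the point with coordinates p and k exchanged,
so they are again values of ψ. -/
theorem hasDerivAt_psi_insertNth (γ : ℝ) {N : ℕ} (lam : Fin (N + 1) → ℂ) (p : Fin (N + 1))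
    {x : Fin N → ℝ} {t : ℝ} (ht : ∀ k, x k ≠ t) :
    HasDerivAt (fun t => psi γ lam (p.insertNth (α := fun _ => ℝ) t x))
      (Complex.I * lam p * psi γ lam (p.insertNth (α := fun _ => ℝ) t x) +
        γ * ∑ k, (((if p.succAbove k < p ∧ x k < t then 1 else 0) -
          (if p < p.succAbove k ∧ t < x k then 1 else 0) : ℝ) : ℂ) *
            psi γ lam (p.insertNth (α := fun _ => ℝ) (x k) (Function.update x k t))) t := by
  set y := p.insertNth (α := fun _ => ℝ) t x with hy
  set w := sortingPerm y with hw
  have hanti : Antitone (permAct w y) := antitone_permAct_sortingPerm y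
  have hev := eventually_antitone_permAct_insertNth ht hanti
  have hd : HasDerivAt (fun s => evalAt w (solutionVec γ lam
      (permAct w y + (s - t) • (Pi.single (w p) 1 : Fin (N + 1) → ℝ))))
      (evalAt w (dunklMatrix γ lam (w p) (solutionVec γ lam (permAct w y)))) t := by
    have h1 := hasDerivAt_solutionVec γ lam (permAct w y) (Pi.single (w p) 1) (t - t)
    have h2 := HasDerivAt.scomp (h := fun s => s - t) t h1 ((hasDerivAt_id t).sub_const t)
    have h3 := (evalAt w).hasFDerivAt.comp_hasDerivAt t h2
    refine h3.congr_deriv ?_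
    simp [dunklSum_single]
  refine (hd.congr_of_eventuallyEq ?_).congr_deriv ?_
  · filter_upwards [hev] with s hs
    rw [psi_eq γ lam hs, permAct_insertNth_add w p x t s]
  · rw [evalAt_dunklMatrix, perm_inv_apply_self, ← psi_eq γ lam hanti,
      ← Equiv.sum_comp w, Fin.sum_univ_succAbove _ p, Finset.mul_sum]
    have h0 : dunklSign w (w p) (w p) = 0 := by simp [dunklSign]
    rw [h0]
    simp only [mul_zero, Complex.ofReal_zero, zero_mul, zero_add]
    congr 1
    refine Finset.sum_congr rfl fun k _ => ?_
    have hyp : permAct w y (w p) = t := by simp [permAct, hy]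
    have hyk : permAct w y (w (p.succAbove k)) = x k := by simp [permAct, hy]
    have hne : w p ≠ w (p.succAbove k) := fun e => Fin.succAbove_ne p k (w.injective e).symm
    have hsign : dunklSign w (w p) (w (p.succAbove k)) =
        (if p.succAbove k < p ∧ x k < t then 1 else 0) -
          (if p < p.succAbove k ∧ t < x k then 1 else 0) := by
      unfold dunklSign
      rw [perm_inv_apply_self, perm_inv_apply_self]
      rcases lt_or_gt_of_ne hne with h1 | h1
      · have h2 := hanti h1.le
        rw [hyp, hyk] at h2
        have h3 := lt_of_le_of_ne h2 (ht k)
        simp [h1, h1.not_gt, h3, h3.not_gt]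
      · have h2 := hanti h1.le
        rw [hyp, hyk] at h2
        have h3 := lt_of_le_of_ne h2 (ht k).symm
        simp [h1, h1.not_gt, h3, h3.not_gt]
    have hswap : Equiv.swap (w p) (w (p.succAbove k)) * w = w * Equiv.swap p (p.succAbove k) := by
      rw [Equiv.swap_apply_apply, inv_mul_cancel_right]
    have hact : permAct (w * Equiv.swap p (p.succAbove k))
        (p.insertNth (α := fun _ => ℝ) (x k) (Function.update x k t)) = permAct w y := by
      rw [← permAct_swap_insertNth, ← permAct_mul, mul_assoc, Equiv.swap_mul_self, mul_one]
    rw [hsign, hswap, psi_eq γ lam (w := w * Equiv.swap p (p.succAbove k)) (by rwa [hact]), hact]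
    push_cast
    ring

/-! ### The wavefunction when the moving coordinate is extremal -/

theorem integralReflection_succAbove (γ : ℝ) {N : ℕ} {p : Fin (N + 1)} {a : Fin (N - 1)}
    {b : Fin (N + 1 - 1)} (hl : lowIdx b = p.succAbove (lowIdx a))
    (hh : highIdx b = p.succAbove (highIdx a)) (g : (Fin N → ℝ) → ℂ) (e : ℝ → ℂ) :
    integralReflection γ b (fun z => g (fun j => z (p.succAbove j)) * e (z p)) =
      fun z => integralReflection γ a g (fun j => z (p.succAbove j)) * e (z p) := by
  funext z
  have h1 : ∀ j, simpleTransposition b (p.succAbove j) =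
      p.succAbove (simpleTransposition a j) := by
    intro j
    unfold simpleTransposition
    rw [hl, hh, ← Fin.coe_succAboveEmb, Function.Injective.swap_apply (p.succAboveEmb).injective]
  have h2 : simpleTransposition b p = p := by
    unfold simpleTransposition
    rw [hl, hh]
    exact Equiv.swap_apply_of_ne_of_ne (Fin.succAbove_ne _ _).symm (Fin.succAbove_ne _ _).symm
  simp only [integralReflection, permFun, permAct, inv_inv, h1, h2, integralOp, hl, hh, add_mul,
    mul_assoc]
  congr 2
  rw [← intervalIntegral.integral_mul_const]
  refine intervalIntegral.integral_congr fun y _ => ?_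
  congr 2
  · funext j
    simp [Pi.single_apply]
  · simp [(Fin.succAbove_ne p _).symm]

theorem planeWave_succAbove {N : ℕ} (lam : Fin (N + 1) → ℂ) (p : Fin (N + 1)) :
    planeWave lam = fun z => planeWave (fun j => lam (p.succAbove j)) (fun j => z (p.succAbove j)) *
      Complex.exp (Complex.I * lam p * (z p : ℂ)) := by
  funext z
  simp only [planeWave, ← Complex.exp_add]
  rw [Fin.sum_univ_succAbove _ p]
  ring_nf

/-- If t is already in its sorted place, a sorting word of x lifts to one that never touches
coordinate p, and the exponential in that coordinate factors out. Adjacent pairs stay adjacent after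
the insertion when p is the first or last index. -/
theorem psi_insertNth_of_antitone (γ : ℝ) {N : ℕ} (lam : Fin (N + 1) → ℂ) (p : Fin (N + 1))
    (lift : Fin (N - 1) → Fin (N + 1 - 1)) (hl : ∀ a, lowIdx (lift a) = p.succAbove (lowIdx a))
    (hh : ∀ a, highIdx (lift a) = p.succAbove (highIdx a)) (x : Fin N → ℝ) (t : ℝ)
    (hanti : Antitone (p.insertNth (α := fun _ => ℝ) t (permAct (sortingPerm x) x))) :
    psi γ lam (p.insertNth (α := fun _ => ℝ) t x) =
      Complex.exp (Complex.I * lam p * t) * psi γ (fun j => lam (p.succAbove j)) x := by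
  have hword : ∀ l : List (Fin (N - 1)), wordOp γ (l.map lift) (planeWave lam) =
      fun z => wordOp γ l (planeWave fun j => lam (p.succAbove j)) (fun j => z (p.succAbove j)) *
        Complex.exp (Complex.I * lam p * (z p : ℂ)) := by
    intro l
    induction l with
    | nil => exact planeWave_succAbove lam p
    | cons a l ih =>
      have h1 : wordOp γ ((a :: l).map lift) (planeWave lam) =
        integralReflection γ (lift a) (wordOp γ (l.map lift) (planeWave lam)) := rfl
      rw [h1, ih, integralReflection_succAbove γ (hl a) (hh a) _
        (fun s : ℝ => Complex.exp (Complex.I * lam p * (s : ℂ)))]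
      rfl
  have hact : ∀ (l : List (Fin (N - 1))) (z : Fin N → ℝ),
      permAct ((l.map lift).map simpleTransposition).prod (p.insertNth (α := fun _ => ℝ) t z) =
        p.insertNth (α := fun _ => ℝ) t (permAct (l.map simpleTransposition).prod z) := by
    intro l
    induction l with
    | nil => intro z; rfl
    | cons a l ih =>
      intro z
      simp only [List.map_cons, List.prod_cons, permAct_mul, ih]
      generalize permAct (List.map simpleTransposition l).prod z = z'
      funext j
      simp only [permAct, simpleTransposition_inv]
      unfold simpleTransposition
      rw [hl, hh]
      rcases eq_or_ne j p with rfl | hj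
      · rw [Equiv.swap_apply_of_ne_of_ne (Fin.succAbove_ne _ _).symm (Fin.succAbove_ne _ _).symm]
        simp
      · obtain ⟨k, rfl⟩ := Fin.exists_succAbove_eq hj
        rw [← Fin.coe_succAboveEmb, Function.Injective.swap_apply (p.succAboveEmb).injective]
        simp [permAct]
  obtain ⟨l, hlw⟩ := exists_word (sortingPerm x)
  have h1 := hact l x
  rw [hlw] at h1
  rw [psi_eq γ lam (w := ((l.map lift).map simpleTransposition).prod) (by rwa [h1]), h1,
    psi_eq γ _ (antitone_permAct_sortingPerm x)]
  have h2 := congrFun (wordOp_planeWave γ lam (l.map lift))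
    (p.insertNth (α := fun _ => ℝ) t (permAct (sortingPerm x) x))
  have h3 := congrFun (wordOp_planeWave γ (fun j => lam (p.succAbove j)) l)
    (permAct (sortingPerm x) x)
  rw [hlw] at h3
  rw [← h2, hword, ← h3]
  simp [mul_comm]

/-! ### Integral equations for the wavefunction -/

theorem continuous_psi_insertNth_update (γ : ℝ) {N : ℕ} (lam : Fin (N + 1) → ℂ) (p : Fin (N + 1))
    (x : Fin N → ℝ) (k : Fin N) : Continuous fun s : ℝ =>
      psi γ lam (p.insertNth (α := fun _ => ℝ) (x k) (Function.update x k s)) := by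
  refine (continuous_psi γ lam).comp (continuous_pi fun j => ?_)
  rcases eq_or_ne j p with rfl | hj
  · simp [continuous_const]
  · obtain ⟨i, rfl⟩ := Fin.exists_succAbove_eq hj
    simp only [Fin.insertNth_apply_succAbove]
    simp only [Function.update_apply]
    split_ifs <;> fun_prop

theorem continuous_psi_insertNth (γ : ℝ) {N : ℕ} (lam : Fin (N + 1) → ℂ) (p : Fin (N + 1))
    (x : Fin N → ℝ) : Continuous fun t : ℝ =>
      psi γ lam (p.insertNth (α := fun _ => ℝ) t x) := by
  refine (continuous_psi γ lam).comp (continuous_pi fun j => ?_)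
  rcases eq_or_ne j p with rfl | hj
  · simp [continuous_id']
  · obtain ⟨i, rfl⟩ := Fin.exists_succAbove_eq hj
    simp [continuous_const]

/-- For the last coordinate only the sources with x k < t survive in the derivative, so the equation
is integrated upward from the region where t is below all x k. -/
theorem psi_snoc (γ : ℝ) {N : ℕ} (lam : Fin (N + 1) → ℂ) (x : Fin N → ℝ) (t : ℝ) :
    psi γ lam (Fin.snoc (α := fun _ => ℝ) x t) =
      Complex.exp (Complex.I * lam (Fin.last N) * t) * psi γ (fun j => lam j.castSucc) x +
        γ * ∑ k, ∫ s in (x k)..max (x k) t, Complex.exp (Complex.I * lam (Fin.last N) * (t - s)) *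
          psi γ lam (Fin.snoc (α := fun _ => ℝ) (Function.update x k s) (x k)) := by
  have hc : ∀ k, Continuous fun s : ℝ =>
      psi γ lam (Fin.snoc (α := fun _ => ℝ) (Function.update x k s) (x k)) := by
    intro k
    simpa only [Fin.insertNth_last'] using
      continuous_psi_insertNth_update γ lam (Fin.last N) x k
  refine variation_of_constants_right
    (φ := fun t => psi γ lam (Fin.snoc (α := fun _ => ℝ) x t))
    (h := fun k s => psi γ lam (Fin.snoc (α := fun _ => ℝ) (Function.update x k s) (x k)))
    (by simpa only [Fin.insertNth_last'] using continuous_psi_insertNth γ lam (Fin.last N) x)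
    hc (fun t ht => ?_) (fun t ht => ?_) t
  · have := hasDerivAt_psi_insertNth γ lam (Fin.last N) ht
    simp only [Fin.insertNth_last'] at this
    refine this.congr_deriv ?_
    congr 2
    refine Finset.sum_congr rfl fun k _ => ?_
    simp only [Fin.succAbove_last, Fin.castSucc_lt_last, true_and,
      (Fin.castSucc_lt_last k).not_gt, false_and, if_false, sub_zero]
    split_ifs <;> simp
  · have := psi_insertNth_of_antitone γ lam (Fin.last N) (fun a => ⟨a, by omega⟩)
      (fun a => by simp [lowIdx]) (fun a => by simp [highIdx]) x t ?_
    · simpa only [Fin.insertNth_last', Fin.succAbove_last] using this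
    · rw [Fin.insertNth_last']
      intro j k hjk
      induction k using Fin.lastCases with
      | last =>
        induction j using Fin.lastCases with
        | last => exact le_rfl
        | cast j => simpa [permAct] using ht _
      | cast k =>
        induction j using Fin.lastCases with
        | last => exact absurd hjk (Fin.castSucc_lt_last k).not_ge
        | cast j => simpa using antitone_permAct_sortingPerm x (Fin.castSucc_le_castSucc_iff.mp hjk)

theorem psi_cons (γ : ℝ) {N : ℕ} (lam : Fin (N + 1) → ℂ) (x : Fin N → ℝ) (t : ℝ) :
    psi γ lam (Fin.cons (α := fun _ => ℝ) t x) =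
      Complex.exp (Complex.I * lam 0 * t) * psi γ (fun j => lam j.succ) x +
        γ * ∑ k, ∫ s in (min (x k) t)..(x k), Complex.exp (Complex.I * lam 0 * (t - s)) *
          psi γ lam (Fin.cons (α := fun _ => ℝ) (x k) (Function.update x k s)) := by
  have hc : ∀ k, Continuous fun s : ℝ =>
      psi γ lam (Fin.cons (α := fun _ => ℝ) (x k) (Function.update x k s)) := by
    intro k
    simpa only [Fin.insertNth_zero'] using
      continuous_psi_insertNth_update γ lam 0 x k
  refine variation_of_constants_left
    (φ := fun t => psi γ lam (Fin.cons (α := fun _ => ℝ) t x))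
    (h := fun k s => psi γ lam (Fin.cons (α := fun _ => ℝ) (x k) (Function.update x k s)))
    (by simpa only [Fin.insertNth_zero'] using continuous_psi_insertNth γ lam 0 x)
    hc (fun t ht => ?_) (fun t ht => ?_) t
  · have := hasDerivAt_psi_insertNth γ lam 0 ht
    simp only [Fin.insertNth_zero'] at this
    refine this.congr_deriv ?_
    rw [sub_eq_add_neg, ← mul_neg, ← Finset.sum_neg_distrib]
    congr 2
    refine Finset.sum_congr rfl fun k _ => ?_
    simp only [Fin.succAbove_zero, Fin.succ_pos, true_and, Fin.not_lt_zero, false_and, if_false,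
      zero_sub]
    split_ifs <;> simp
  · have := psi_insertNth_of_antitone γ lam 0 (fun a => ⟨a + 1, by omega⟩)
      (fun a => by simp [lowIdx]) (fun a => by simp [highIdx]) x t ?_
    · simpa only [Fin.insertNth_zero', Fin.succAbove_zero] using this
    · rw [Fin.insertNth_zero']
      intro j k hjk
      induction j using Fin.cases with
      | zero =>
        induction k using Fin.cases with
        | zero => exact le_rfl
        | succ k => simpa [permAct] using ht _
      | succ j =>
        induction k using Fin.cases with
        | zero => exact absurd hjk (Fin.succ_pos j).not_ge
        | succ k => simpa using antitone_permAct_sortingPerm x (Fin.succ_le_succ_iff.mp hjk)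

/-! ### Uniqueness for the integral equations -/

/-- Induction on the number of coordinates below the last one. In the integrand the last coordinate
drops to x k while the k-th becomes s > x k, so k leaves the count and nothing enters it. -/
theorem eq_of_snoc_equation {N : ℕ} {c g : ℂ} {f : (Fin N → ℝ) → ℂ}
    {Φ Φ' : (Fin (N + 1) → ℝ) → ℂ}
    (h : ∀ x t, Φ (Fin.snoc (α := fun _ => ℝ) x t) = Complex.exp (c * (t : ℝ)) * f x +
      g * ∑ k, ∫ s in (x k)..max (x k) t, Complex.exp (c * (t - s)) *
        Φ (Fin.snoc (α := fun _ => ℝ) (Function.update x k s) (x k)))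
    (h' : ∀ x t, Φ' (Fin.snoc (α := fun _ => ℝ) x t) = Complex.exp (c * (t : ℝ)) * f x +
      g * ∑ k, ∫ s in (x k)..max (x k) t, Complex.exp (c * (t - s)) *
        Φ' (Fin.snoc (α := fun _ => ℝ) (Function.update x k s) (x k))) : Φ = Φ' := by
  have key : ∀ (n : ℕ) (x : Fin N → ℝ) (t : ℝ), (Finset.univ.filter fun k => x k < t).card = n →
      Φ (Fin.snoc (α := fun _ => ℝ) x t) = Φ' (Fin.snoc (α := fun _ => ℝ) x t) := by
    intro n
    induction n using Nat.strong_induction_on with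
    | _ n ih =>
      intro x t hn
      rw [h, h']
      congr 2
      refine Finset.sum_congr rfl fun k _ => ?_
      refine intervalIntegral.integral_congr_Ioo_of_le (le_max_left _ _) fun s hs => ?_
      have hk : x k < t := by simpa using hs.1.trans hs.2
      rw [ih _ _ _ _ rfl]
      rw [← hn]
      refine Finset.card_lt_card ⟨fun i hi => ?_, fun hsub => ?_⟩
      · simp only [Finset.mem_filter, Finset.mem_univ, true_and] at hi ⊢
        rcases eq_or_ne i k with rfl | hik
        · exact hk
        · rw [Function.update_of_ne hik] at hi
          exact hi.trans hk
      · have := hsub (x := k) (by simpa using hk)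
        simp only [Finset.mem_filter, Finset.mem_univ, true_and, Function.update_self] at this
        exact lt_asymm this hs.1
  funext z
  rw [← Fin.snoc_init_self z]
  exact key _ _ _ rfl

theorem eq_of_cons_equation {N : ℕ} {c g : ℂ} {f : (Fin N → ℝ) → ℂ}
    {Φ Φ' : (Fin (N + 1) → ℝ) → ℂ}
    (h : ∀ x t, Φ (Fin.cons (α := fun _ => ℝ) t x) = Complex.exp (c * (t : ℝ)) * f x +
      g * ∑ k, ∫ s in (min (x k) t)..(x k), Complex.exp (c * (t - s)) *
        Φ (Fin.cons (α := fun _ => ℝ) (x k) (Function.update x k s)))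
    (h' : ∀ x t, Φ' (Fin.cons (α := fun _ => ℝ) t x) = Complex.exp (c * (t : ℝ)) * f x +
      g * ∑ k, ∫ s in (min (x k) t)..(x k), Complex.exp (c * (t - s)) *
        Φ' (Fin.cons (α := fun _ => ℝ) (x k) (Function.update x k s))) : Φ = Φ' := by
  have key : ∀ (n : ℕ) (x : Fin N → ℝ) (t : ℝ), (Finset.univ.filter fun k => t < x k).card = n →
      Φ (Fin.cons (α := fun _ => ℝ) t x) = Φ' (Fin.cons (α := fun _ => ℝ) t x) := by
    intro n
    induction n using Nat.strong_induction_on with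
    | _ n ih =>
      intro x t hn
      rw [h, h']
      congr 2
      refine Finset.sum_congr rfl fun k _ => ?_
      refine intervalIntegral.integral_congr_Ioo_of_le (min_le_left _ _) fun s hs => ?_
      have hk : t < x k := by simpa using hs.1.trans hs.2
      rw [ih _ _ _ _ rfl]
      rw [← hn]
      refine Finset.card_lt_card ⟨fun i hi => ?_, fun hsub => ?_⟩
      · simp only [Finset.mem_filter, Finset.mem_univ, true_and] at hi ⊢
        rcases eq_or_ne i k with rfl | hik
        · exact hk
        · rw [Function.update_of_ne hik] at hi
          exact hk.trans hi
      · have := hsub (x := k) (by simpa using hk)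
        simp only [Finset.mem_filter, Finset.mem_univ, true_and, Function.update_self] at this
        exact lt_asymm this hs.2
  funext z
  rw [← Fin.cons_self_tail z]
  exact key _ _ _ rfl

/-! ### Iterated integrals -/

theorem iteratedIntegral_const_mul {n : ℕ} (a b : Fin n → ℝ) (c : ℂ) (F : (Fin n → ℝ) → ℂ) :
    iteratedIntegral a b (fun y => c * F y) = c * iteratedIntegral a b F := by
  induction n with
  | zero => rfl
  | succ n ih =>
    simp only [iteratedIntegral, ih]
    exact intervalIntegral.integral_const_mul _ _

theorem continuous_cons_real {X : Type*} [TopologicalSpace X] {n : ℕ} {s : X → ℝ}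
    {y : X → Fin n → ℝ} (hs : Continuous s) (hy : Continuous y) :
    Continuous fun x => (Fin.cons (s x) (y x) : Fin (n + 1) → ℝ) := by
  refine continuous_pi fun j => ?_
  induction j using Fin.cases with
  | zero => simpa using hs
  | succ j => simpa using (continuous_apply j).comp' hy

theorem continuous_snoc_real {X : Type*} [TopologicalSpace X] {n : ℕ} {s : X → ℝ}
    {y : X → Fin n → ℝ} (hs : Continuous s) (hy : Continuous y) :
    Continuous fun x => (Fin.snoc (y x) (s x) : Fin (n + 1) → ℝ) := by
  refine continuous_pi fun j => ?_
  induction j using Fin.lastCases with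
  | last => simpa using hs
  | cast j => simpa using (continuous_apply j).comp' hy

theorem continuous_iteratedIntegral {X : Type*} [TopologicalSpace X] [FirstCountableTopology X]
    {n : ℕ} (a b : Fin n → ℝ) {F : X → (Fin n → ℝ) → ℂ}
    (hF : Continuous fun p : X × (Fin n → ℝ) => F p.1 p.2) :
    Continuous fun x => iteratedIntegral a b (F x) := by
  induction n generalizing X with
  | zero => exact hF.comp (continuous_id.prodMk continuous_const)
  | succ n ih =>
    refine intervalIntegral.continuous_parametric_intervalIntegral_of_continuous'
      (f := fun x y => iteratedIntegral (Fin.tail a) (Fin.tail b) fun ys => F x (Fin.cons y ys))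
      ?_ _ _
    refine ih (X := X × ℝ) (Fin.tail a) (Fin.tail b)
      (F := fun p ys => F p.1 (Fin.cons p.2 ys)) ?_
    exact hF.comp ((continuous_fst.comp continuous_fst).prodMk
      (continuous_cons_real (continuous_snd.comp continuous_fst) continuous_snd))

/-- Fubini brings the innermost variable outside. The recursion for b^+ needs it, since there the
index next to the moving coordinate is the last one. -/
theorem iteratedIntegral_snoc {n : ℕ} (a b : Fin (n + 1) → ℝ) {F : (Fin (n + 1) → ℝ) → ℂ}
    (hF : Continuous F) :
    iteratedIntegral a b F = ∫ s in (a (Fin.last n))..(b (Fin.last n)),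
      iteratedIntegral (Fin.init a) (Fin.init b) (fun ys => F (Fin.snoc ys s)) := by
  induction n with
  | zero =>
    simp only [iteratedIntegral]
    refine intervalIntegral.integral_congr fun s _ => ?_
    refine congrArg F (funext fun j => ?_)
    obtain rfl : j = 0 := Fin.fin_one_eq_zero j
    rfl
  | succ n ih =>
    have h1 : ∀ y : ℝ, iteratedIntegral (Fin.tail a) (Fin.tail b) (fun ys => F (Fin.cons y ys)) =
        ∫ s in (a (Fin.last (n + 1)))..(b (Fin.last (n + 1))),
          iteratedIntegral (Fin.tail (Fin.init a)) (Fin.tail (Fin.init b))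
            (fun ys => F (Fin.snoc (Fin.cons y ys : Fin (n + 1) → ℝ) s)) := by
      intro y
      rw [ih (Fin.tail a) (Fin.tail b) (F := fun ys => F (Fin.cons y ys))
        (hF.comp (continuous_cons_real continuous_const continuous_id))]
      refine intervalIntegral.integral_congr fun s _ => ?_
      simp only [Fin.cons_snoc_eq_snoc_cons]
      rfl
    have h2 : iteratedIntegral a b F = ∫ y in (a 0)..(b 0),
        iteratedIntegral (Fin.tail a) (Fin.tail b) (fun ys => F (Fin.cons y ys)) := rfl
    rw [h2, intervalIntegral.integral_congr fun y _ => h1 y]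
    rw [MeasureTheory.intervalIntegral_intervalIntegral_swap]
    · rfl
    · have hc : Continuous (Function.uncurry fun y s : ℝ =>
          iteratedIntegral (Fin.tail (Fin.init a)) (Fin.tail (Fin.init b))
            (fun ys => F (Fin.snoc (Fin.cons y ys : Fin (n + 1) → ℝ) s))) := by
        refine continuous_iteratedIntegral (X := ℝ × ℝ) _ _
          (F := fun p ys => F (Fin.snoc (Fin.cons p.1 ys : Fin (n + 1) → ℝ) p.2)) ?_
        exact hF.comp (continuous_snoc_real (continuous_snd.comp continuous_fst)
          (continuous_cons_real (continuous_fst.comp continuous_fst) continuous_snd))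
      exact (hc.continuousOn.integrableOn_compact
        (isCompact_uIcc.prod isCompact_uIcc)).mono_set
        (Set.prod_mono Set.uIoc_subset_uIcc Set.uIoc_subset_uIcc)

open Classical in
/-- The iterated integral over the box with sides `[y_{m+1}, y_m]`, if `y` is strictly decreasing,
and `0` otherwise. -/
def descIntegral {n : ℕ} (y : Fin (n + 1) → ℝ) (F : (Fin n → ℝ) → ℂ) : ℂ :=
  if ∀ m : Fin n, y m.succ < y m.castSucc then
    iteratedIntegral (fun m => y m.succ) (fun m => y m.castSucc) F else 0

theorem descIntegral_const_mul {n : ℕ} (y : Fin (n + 1) → ℝ) (c : ℂ) (F : (Fin n → ℝ) → ℂ) :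
    descIntegral y (fun z => c * F z) = c * descIntegral y F := by
  unfold descIntegral
  split_ifs
  · exact iteratedIntegral_const_mul _ _ _ _
  · simp

theorem continuous_descIntegral {X : Type*} [TopologicalSpace X] [FirstCountableTopology X]
    {n : ℕ} (y : Fin (n + 1) → ℝ) {F : X → (Fin n → ℝ) → ℂ}
    (hF : Continuous fun p : X × (Fin n → ℝ) => F p.1 p.2) :
    Continuous fun x => descIntegral y (F x) := by
  unfold descIntegral
  split_ifs
  · exact continuous_iteratedIntegral _ _ hF
  · exact continuous_const

/-- The upper limit max(y 0, z) absorbs one inequality of the step function: if it fails, the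
interval is degenerate. -/
theorem descIntegral_cons {n : ℕ} (z : ℝ) (y : Fin (n + 1) → ℝ) (F : (Fin (n + 1) → ℝ) → ℂ) :
    descIntegral (Fin.cons z y : Fin (n + 2) → ℝ) F =
      ∫ s in (y 0)..max (y 0) z, descIntegral y (fun ys => F (Fin.cons s ys)) := by
  have hiff : (∀ m : Fin (n + 1), (Fin.cons z y : Fin (n + 2) → ℝ) m.succ <
      (Fin.cons z y : Fin (n + 2) → ℝ) m.castSucc) ↔
      y 0 < z ∧ ∀ m : Fin n, y m.succ < y m.castSucc := by
    rw [Fin.forall_fin_succ]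
    rfl
  by_cases hz : y 0 < z
  · rw [max_eq_right hz.le]
    unfold descIntegral
    by_cases hy : ∀ m : Fin n, y m.succ < y m.castSucc
    · rw [if_pos (hiff.mpr ⟨hz, hy⟩)]
      simp only [if_pos hy]
      rfl
    · rw [if_neg fun h => hy (hiff.mp h).2]
      simp only [if_neg hy, intervalIntegral.integral_zero]
  · rw [max_eq_left (not_lt.mp hz), intervalIntegral.integral_same, descIntegral,
      if_neg fun h => hz (hiff.mp h).1]

theorem descIntegral_snoc {n : ℕ} (z : ℝ) (y : Fin (n + 1) → ℝ) {F : (Fin (n + 1) → ℝ) → ℂ}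
    (hF : Continuous F) :
    descIntegral (Fin.snoc y z : Fin (n + 2) → ℝ) F =
      ∫ s in (min (y (Fin.last n)) z)..(y (Fin.last n)),
        descIntegral y (fun ys => F (Fin.snoc ys s)) := by
  have hiff : (∀ m : Fin (n + 1), (Fin.snoc y z : Fin (n + 2) → ℝ) m.succ <
      (Fin.snoc y z : Fin (n + 2) → ℝ) m.castSucc) ↔
      z < y (Fin.last n) ∧ ∀ m : Fin n, y m.succ < y m.castSucc := by
    rw [Fin.forall_fin_succ', and_comm]
    simp only [Fin.succ_last, Fin.snoc_last, Fin.snoc_castSucc, Fin.succ_castSucc]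
  by_cases hz : z < y (Fin.last n)
  · rw [min_eq_right hz.le]
    unfold descIntegral
    by_cases hy : ∀ m : Fin n, y m.succ < y m.castSucc
    · rw [if_pos (hiff.mpr ⟨hz, hy⟩)]
      simp only [if_pos hy]
      rw [iteratedIntegral_snoc _ _ hF]
      unfold Fin.init
      simp only [Fin.succ_last, Fin.snoc_last, Fin.snoc_castSucc, Fin.succ_castSucc]
    · rw [if_neg fun h => hy (hiff.mp h).2]
      simp only [if_neg hy, intervalIntegral.integral_zero]
  · rw [min_eq_left (not_lt.mp hz), intervalIntegral.integral_same, descIntegral,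
      if_neg fun h => hz (hiff.mp h).1]

/-! ### Recursion for the creation operators -/

/-- The integrand of the elementary creation operators. -/
def creationKernel (μ : ℂ) {N n : ℕ} (i : Fin n ↪ Fin N) (f : (Fin N → ℝ) → ℂ) (x : Fin N → ℝ)
    (y : Fin n → ℝ) : ℂ :=
  (∏ m, Complex.exp (Complex.I * μ * ((x (i m) : ℂ) - (y m : ℂ)))) * f (substitute i y x)

theorem eMinus_snoc (μ : ℂ) {N n : ℕ} (i : Fin n ↪ Fin N) (f : (Fin N → ℝ) → ℂ)
    (x : Fin N → ℝ) (t : ℝ) :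
    eMinus μ i f (Fin.snoc (α := fun _ => ℝ) x t) = Complex.exp (Complex.I * μ * t) *
      descIntegral (Fin.cons t (fun m => x (i m)) : Fin (n + 1) → ℝ) (creationKernel μ i f x) := by
  have h : ∀ m, Fin.snoc (α := fun _ => ℝ) x t (minusLabels i m) =
      (Fin.cons t (fun m => x (i m)) : Fin (n + 1) → ℝ) m := by
    intro m
    induction m using Fin.cases with
    | zero => simp [minusLabels]
    | succ m => simp [minusLabels]
  unfold eMinus step descIntegral
  simp only [h, Fin.snoc_last, Fin.snoc_castSucc]
  split_ifs
  · rw [mul_one]; rfl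
  · simp

theorem ePlus_cons (μ : ℂ) {N n : ℕ} (i : Fin n ↪ Fin N) (f : (Fin N → ℝ) → ℂ)
    (x : Fin N → ℝ) (t : ℝ) :
    ePlus μ i f (Fin.cons (α := fun _ => ℝ) t x) = Complex.exp (Complex.I * μ * t) *
      descIntegral (Fin.snoc (fun m => x (i m)) t : Fin (n + 1) → ℝ) (creationKernel μ i f x) := by
  have h : ∀ m, Fin.cons (α := fun _ => ℝ) t x (plusLabels i m) =
      (Fin.snoc (fun m => x (i m)) t : Fin (n + 1) → ℝ) m := by
    intro m
    induction m using Fin.lastCases with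
    | last => simp [plusLabels]
    | cast m => simp [plusLabels]
  unfold ePlus step descIntegral
  simp only [h, Fin.cons_zero, Fin.cons_succ]
  split_ifs
  · rw [mul_one]; rfl
  · simp

theorem substitute_apply_self {N n : ℕ} (i : Fin n ↪ Fin N) (y : Fin n → ℝ) (x : Fin N → ℝ)
    (m : Fin n) : substitute i y x (i m) = y m := i.injective.extend_apply _ _ _

theorem substitute_apply_of_notMem {N n : ℕ} (i : Fin n ↪ Fin N) (y : Fin n → ℝ)
    (x : Fin N → ℝ) {j : Fin N} (hj : ∀ m, i m ≠ j) : substitute i y x j = x j :=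
  Function.extend_apply' _ _ _ fun ⟨m, hm⟩ => hj m hm

theorem creationKernel_cons (μ : ℂ) {N n : ℕ} (i : Fin (n + 1) ↪ Fin N) (f : (Fin N → ℝ) → ℂ)
    (x : Fin N → ℝ) (s : ℝ) (y : Fin n → ℝ) :
    creationKernel μ i f x (Fin.cons s y) = Complex.exp (Complex.I * μ * ((x (i 0) : ℂ) - s)) *
      creationKernel μ ((Fin.succEmb n).trans i) f (Function.update x (i 0) s) y := by
  have h2 : substitute i (Fin.cons s y) x =
      substitute ((Fin.succEmb n).trans i) y (Function.update x (i 0) s) := by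
    funext j
    by_cases hj : ∃ m, i m = j
    · obtain ⟨m, rfl⟩ := hj
      rw [substitute_apply_self]
      induction m using Fin.cases with
      | zero =>
        rw [substitute_apply_of_notMem _ _ _ (fun m => by simp)]
        simp
      | succ m => exact (substitute_apply_self ((Fin.succEmb n).trans i) y _ m).symm
    · push Not at hj
      rw [substitute_apply_of_notMem _ _ _ hj, substitute_apply_of_notMem _ _ _ fun m => hj m.succ,
        Function.update_of_ne (hj 0).symm]
  unfold creationKernel
  rw [h2, Fin.prod_univ_succ, mul_assoc]
  simp

theorem creationKernel_snoc (μ : ℂ) {N n : ℕ} (i : Fin (n + 1) ↪ Fin N) (f : (Fin N → ℝ) → ℂ)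
    (x : Fin N → ℝ) (s : ℝ) (y : Fin n → ℝ) :
    creationKernel μ i f x (Fin.snoc y s) =
      Complex.exp (Complex.I * μ * ((x (i (Fin.last n)) : ℂ) - s)) *
        creationKernel μ (Fin.castSuccEmb.trans i) f
          (Function.update x (i (Fin.last n)) s) y := by
  have h2 : substitute i (Fin.snoc y s) x =
      substitute (Fin.castSuccEmb.trans i) y
        (Function.update x (i (Fin.last n)) s) := by
    funext j
    by_cases hj : ∃ m, i m = j
    · obtain ⟨m, rfl⟩ := hj
      rw [substitute_apply_self]
      induction m using Fin.lastCases with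
      | last =>
        rw [substitute_apply_of_notMem _ _ _ (fun m => by simp [(Fin.castSucc_lt_last m).ne])]
        simp
      | cast m =>
        rw [Fin.snoc_castSucc]
        exact (substitute_apply_self (Fin.castSuccEmb.trans i) y _ m).symm
    · push Not at hj
      rw [substitute_apply_of_notMem _ _ _ hj,
        substitute_apply_of_notMem _ _ _ fun m => hj m.castSucc,
        Function.update_of_ne (hj _).symm]
  unfold creationKernel
  rw [h2, Fin.prod_univ_castSucc, mul_comm (∏ _, _), mul_assoc]
  simp

theorem continuous_creationKernel {X : Type*} [TopologicalSpace X] (μ : ℂ) {N n : ℕ}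
    (i : Fin n ↪ Fin N) {f : (Fin N → ℝ) → ℂ} (hf : Continuous f) {x : X → Fin N → ℝ}
    {y : X → Fin n → ℝ} (hx : Continuous x) (hy : Continuous y) :
    Continuous fun p => creationKernel μ i f (x p) (y p) := by
  have hs : Continuous fun p => substitute i (y p) (x p) := by
    refine continuous_pi fun j => ?_
    by_cases hj : ∃ m, i m = j
    · obtain ⟨m, rfl⟩ := hj
      simp only [substitute_apply_self]
      fun_prop
    · push Not at hj
      simp only [substitute_apply_of_notMem _ _ _ hj]
      fun_prop
  unfold creationKernel
  fun_prop

/-- Once the first integration variable s replaces the coordinate at i 0, the old value of that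
coordinate serves as the last coordinate for the shorter tuple; the exponentials regroup
accordingly. -/
theorem eMinus_succ (μ : ℂ) {N n : ℕ} (i : Fin (n + 1) ↪ Fin N) (f : (Fin N → ℝ) → ℂ)
    (x : Fin N → ℝ) (t : ℝ) :
    eMinus μ i f (Fin.snoc (α := fun _ => ℝ) x t) =
      ∫ s in (x (i 0))..max (x (i 0)) t, Complex.exp (Complex.I * μ * (t - s)) *
        eMinus μ ((Fin.succEmb n).trans i) f
          (Fin.snoc (α := fun _ => ℝ) (Function.update x (i 0) s) (x (i 0))) := by
  have hy : ∀ s : ℝ, (Fin.cons (x (i 0)) (fun m => Function.update x (i 0) s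
      (((Fin.succEmb n).trans i) m)) : Fin (n + 1) → ℝ) = fun m => x (i m) := by
    intro s
    funext m
    induction m using Fin.cases with
    | zero => rfl
    | succ m => simp
  rw [eMinus_snoc, descIntegral_cons, ← intervalIntegral.integral_const_mul]
  refine intervalIntegral.integral_congr fun s _ => ?_
  simp only [creationKernel_cons, descIntegral_const_mul, eMinus_snoc, hy]
  rw [← mul_assoc, ← mul_assoc, ← Complex.exp_add, ← Complex.exp_add]
  ring_nf

theorem ePlus_succ (μ : ℂ) {N n : ℕ} (i : Fin (n + 1) ↪ Fin N) {f : (Fin N → ℝ) → ℂ}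
    (hf : Continuous f) (x : Fin N → ℝ) (t : ℝ) :
    ePlus μ i f (Fin.cons (α := fun _ => ℝ) t x) =
      ∫ s in (min (x (i (Fin.last n))) t)..(x (i (Fin.last n))),
        Complex.exp (Complex.I * μ * (t - s)) *
          ePlus μ (Fin.castSuccEmb.trans i) f (Fin.cons (α := fun _ => ℝ)
            (x (i (Fin.last n))) (Function.update x (i (Fin.last n)) s)) := by
  have hy : ∀ s : ℝ, (Fin.snoc (fun m => Function.update x (i (Fin.last n)) s
      ((Fin.castSuccEmb.trans i) m)) (x (i (Fin.last n))) : Fin (n + 1) → ℝ) =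
        fun m => x (i m) := by
    intro s
    funext m
    induction m using Fin.lastCases with
    | last => simp
    | cast m => simp
  have hK : Continuous (creationKernel μ i f x) :=
    continuous_creationKernel μ i hf continuous_const continuous_id
  rw [ePlus_cons, descIntegral_snoc _ _ hK,
    ← intervalIntegral.integral_const_mul]
  refine intervalIntegral.integral_congr fun s _ => ?_
  simp only [creationKernel_snoc, descIntegral_const_mul, ePlus_cons, hy]
  rw [← mul_assoc, ← mul_assoc, ← Complex.exp_add, ← Complex.exp_add]
  ring_nf

/-! ### Sums over tuples of distinct indices -/

open Classical in
theorem sum_embedding_succ {α : Type*} [Fintype α] [DecidableEq α] {n : ℕ} (F : (Fin n ↪ α) → α → ℂ) :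
    ∑ i : Fin (n + 1) ↪ α, F ((Fin.succEmb n).trans i) (i 0) =
      ∑ k, ∑ i : Fin n ↪ α, if k ∈ Set.range i then 0 else F i k := by
  rw [Finset.sum_comm, ← Equiv.sum_comp (Equiv.embeddingFinSucc n α).symm, Fintype.sum_sigma]
  refine Finset.sum_congr rfl fun i _ => ?_
  have h : ∀ k : {k // k ∉ Set.range i},
      F ((Fin.succEmb n).trans ((Equiv.embeddingFinSucc n α).symm ⟨i, k⟩))
        ((Equiv.embeddingFinSucc n α).symm ⟨i, k⟩ 0) = F i k := by
    intro k
    congr 1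
  rw [Finset.sum_congr rfl fun k _ => h k,
    ← Finset.sum_subtype (Finset.univ.filter fun k => k ∉ Set.range i) (by simp) (F i),
    Finset.sum_filter]
  simp only [ite_not]

open Classical in
theorem sum_embedding_castSucc {α : Type*} [Fintype α] [DecidableEq α] {n : ℕ} (F : (Fin n ↪ α) → α → ℂ) :
    ∑ i : Fin (n + 1) ↪ α, F (Fin.castSuccEmb.trans i) (i (Fin.last n)) =
      ∑ k, ∑ i : Fin n ↪ α, if k ∈ Set.range i then 0 else F i k := by
  rw [← sum_embedding_succ]
  -- Rotating the tuple moves its last entry to the front.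
  refine Fintype.sum_equiv ((finRotate (n + 1)).embeddingCongr (Equiv.refl α)) _ _ fun i => ?_
  have h0 : (finRotate (n + 1)).symm 0 = Fin.last n := by
    rw [Equiv.symm_apply_eq, finRotate_last]
  have h1 : ∀ m : Fin n, (finRotate (n + 1)).symm m.succ = m.castSucc := by
    intro m
    rw [Equiv.symm_apply_eq, finRotate_apply, Fin.coeSucc_eq_succ]
  have h2 : i (Fin.last n) =
      ((finRotate (n + 1)).embeddingCongr (Equiv.refl α)) i 0 := congrArg i h0.symm
  rw [h2]
  congr 1
  ext m
  exact congrArg i (h1 m).symm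

-- The bookkeeping common to b^- and b^+. Splitting off one index k leaves tuples avoiding k; by
-- `hzero` the tuples containing k may be added back under the integral, which rebuilds the full
-- operator there.
open Classical in
theorem sum_range_eq_integral {N : ℕ} {g : ℂ} {E : (n : ℕ) → (Fin n ↪ Fin N) → ℂ}
    {E' : (n : ℕ) → (Fin n ↪ Fin N) → Fin N → ℝ → ℂ} {e : ℝ → ℂ} {a b : Fin N → ℝ}
    (hab : ∀ k, a k ≤ b k)
    (hsucc : ∀ n, ∑ i : Fin (n + 1) ↪ Fin N, E (n + 1) i = ∑ k, ∑ i : Fin n ↪ Fin N,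
      if k ∈ Set.range i then 0 else ∫ s in (a k)..(b k), e s * E' n i k s)
    (hzero : ∀ n (i : Fin n ↪ Fin N), ∀ k ∈ Set.range i, ∀ s ∈ Set.Ioo (a k) (b k),
      E' n i k s = 0)
    (hcont : ∀ n (i : Fin n ↪ Fin N), ∀ k ∉ Set.range i, Continuous (E' n i k))
    (he : Continuous e) :
    ∑ n ∈ Finset.range (N + 1), g ^ n * ∑ i : Fin n ↪ Fin N, E n i =
      (∑ i : Fin 0 ↪ Fin N, E 0 i) + g * ∑ k, ∫ s in (a k)..(b k),
        e s * ∑ n ∈ Finset.range (N + 1), g ^ n * ∑ i : Fin n ↪ Fin N, E' n i k s := by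
  have hint : ∀ k, ∫ s in (a k)..(b k),
      e s * ∑ n ∈ Finset.range (N + 1), g ^ n * ∑ i : Fin n ↪ Fin N, E' n i k s =
      ∑ n ∈ Finset.range N, g ^ n * ∑ i : Fin n ↪ Fin N,
        if k ∈ Set.range i then 0 else ∫ s in (a k)..(b k), e s * E' n i k s := by
    intro k
    have h1 : ∀ n (i : Fin n ↪ Fin N),
        Continuous fun s => if k ∈ Set.range i then 0 else e s * E' n i k s := by
      intro n i
      split_ifs with h
      · exact continuous_const
      · exact he.mul (hcont n i k h)
    have h2 : ∫ s in (a k)..(b k),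
        e s * ∑ n ∈ Finset.range (N + 1), g ^ n * ∑ i : Fin n ↪ Fin N, E' n i k s =
        ∫ s in (a k)..(b k), ∑ n ∈ Finset.range (N + 1), g ^ n * ∑ i : Fin n ↪ Fin N,
          if k ∈ Set.range i then 0 else e s * E' n i k s := by
      refine intervalIntegral.integral_congr_Ioo_of_le (hab k) fun s hs => ?_
      simp only [Finset.mul_sum]
      refine Finset.sum_congr rfl fun n _ => Finset.sum_congr rfl fun i _ => ?_
      split_ifs with h
      · rw [hzero n i k h s hs]; simp
      · ring
    have h3 : ∀ (n : ℕ), ∫ s in (a k)..(b k), g ^ n * ∑ i : Fin n ↪ Fin N,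
        (if k ∈ Set.range i then 0 else e s * E' n i k s) = g ^ n * ∑ i : Fin n ↪ Fin N,
          if k ∈ Set.range i then 0 else ∫ s in (a k)..(b k), e s * E' n i k s := by
      intro n
      rw [intervalIntegral.integral_const_mul,
        intervalIntegral.integral_finsetSum fun i _ => (h1 n i).intervalIntegrable _ _]
      congr 1
      refine Finset.sum_congr rfl fun i _ => ?_
      split_ifs <;> simp
    have h4 : ∀ n, Continuous fun s => g ^ n * ∑ i : Fin n ↪ Fin N,
        if k ∈ Set.range i then 0 else e s * E' n i k s := fun n =>
      continuous_const.mul (continuous_finsetSum _ fun i _ => h1 n i)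
    rw [h2, intervalIntegral.integral_finsetSum fun n _ => (h4 n).intervalIntegrable _ _,
      Finset.sum_congr rfl fun n _ => h3 n,
      Finset.sum_range_succ]
    -- An N-tuple of distinct indices contains k, so the top term drops and the shift from n to n +
    -- 1 matches the ranges.
    have hlast : ∀ i : Fin N ↪ Fin N, k ∈ Set.range i := fun i =>
      (Finite.injective_iff_surjective.mp i.injective) k
    simp [hlast]
  simp only [hint]
  rw [Finset.sum_range_succ', add_comm]
  congr 1
  · simp
  · rw [Finset.sum_comm, Finset.mul_sum]
    refine Finset.sum_congr rfl fun n _ => ?_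
    rw [hsucc, ← Finset.mul_sum, pow_succ']
    ring

/-! ### The creation operators solve the integral equations -/

theorem bMinus_snoc (γ : ℝ) (μ : ℂ) {N : ℕ} {f : (Fin N → ℝ) → ℂ} (hf : Continuous f)
    (x : Fin N → ℝ) (t : ℝ) :
    bMinus γ μ f (Fin.snoc (α := fun _ => ℝ) x t) = Complex.exp (Complex.I * μ * t) * f x +
      γ * ∑ k, ∫ s in (x k)..max (x k) t, Complex.exp (Complex.I * μ * (t - s)) *
        bMinus γ μ f (Fin.snoc (α := fun _ => ℝ) (Function.update x k s) (x k)) := by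
  have h0 : ∑ i : Fin 0 ↪ Fin N, eMinus μ i f (Fin.snoc (α := fun _ => ℝ) x t) =
      Complex.exp (Complex.I * μ * t) * f x := by
    have hx : ∀ i : Fin 0 ↪ Fin N, substitute i Fin.elim0 x = x := fun i =>
      funext fun j => substitute_apply_of_notMem _ _ _ fun m => m.elim0
    simp [eMinus_snoc, descIntegral, iteratedIntegral, creationKernel, hx]
  rw [← h0]
  refine sum_range_eq_integral (E := fun n i => eMinus μ i f (Fin.snoc (α := fun _ => ℝ) x t))
    (E' := fun n i k s => eMinus μ i f
      (Fin.snoc (α := fun _ => ℝ) (Function.update x k s) (x k)))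
    (e := fun s => Complex.exp (Complex.I * μ * (t - s))) (fun k => le_max_left _ _)
    (fun n => ?_) (fun n i k hk s hs => ?_) (fun n i k hk => ?_) (by fun_prop)
  · exact (Finset.sum_congr rfl fun i _ => eMinus_succ μ i f x t).trans
      (sum_embedding_succ fun i k => ∫ s in (x k)..max (x k) t,
        Complex.exp (Complex.I * μ * (t - s)) *
          eMinus μ i f (Fin.snoc (α := fun _ => ℝ) (Function.update x k s) (x k)))
  -- If k belongs to the tuple, its coordinate s would have to lie below the last coordinate x k,
  -- but s > x k; the step function vanishes.
  · obtain ⟨m, rfl⟩ := hk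
    rw [eMinus_snoc, descIntegral, if_neg, mul_zero]
    intro h
    have hanti := (Fin.strictAnti_iff_succ_lt.mpr h) (Fin.succ_pos m)
    simp only [Fin.cons_succ, Function.update_self, Fin.cons_zero] at hanti
    exact lt_asymm hanti hs.1
  -- If k is not in the tuple, s enters only through the integrand and not through the limits or the
  -- step function.
  · have hne : ∀ m, i m ≠ k := fun m hm => hk ⟨m, hm⟩
    simp only [eMinus_snoc, Function.update_of_ne (hne _)]
    refine continuous_const.mul (continuous_descIntegral _ ?_)
    exact continuous_creationKernel μ i hf
      (continuous_const.update k continuous_fst) continuous_snd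

theorem bPlus_cons (γ : ℝ) (μ : ℂ) {N : ℕ} {f : (Fin N → ℝ) → ℂ} (hf : Continuous f)
    (x : Fin N → ℝ) (t : ℝ) :
    bPlus γ μ f (Fin.cons (α := fun _ => ℝ) t x) = Complex.exp (Complex.I * μ * t) * f x +
      γ * ∑ k, ∫ s in (min (x k) t)..(x k), Complex.exp (Complex.I * μ * (t - s)) *
        bPlus γ μ f (Fin.cons (α := fun _ => ℝ) (x k) (Function.update x k s)) := by
  have h0 : ∑ i : Fin 0 ↪ Fin N, ePlus μ i f (Fin.cons (α := fun _ => ℝ) t x) =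
      Complex.exp (Complex.I * μ * t) * f x := by
    have hx : ∀ i : Fin 0 ↪ Fin N, substitute i Fin.elim0 x = x := fun i =>
      funext fun j => substitute_apply_of_notMem _ _ _ fun m => m.elim0
    simp [ePlus_cons, descIntegral, iteratedIntegral, creationKernel, hx]
  rw [← h0]
  refine sum_range_eq_integral (E := fun n i => ePlus μ i f (Fin.cons (α := fun _ => ℝ) t x))
    (E' := fun n i k s => ePlus μ i f
      (Fin.cons (α := fun _ => ℝ) (x k) (Function.update x k s)))
    (e := fun s => Complex.exp (Complex.I * μ * (t - s))) (fun k => min_le_left _ _)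
    (fun n => ?_) (fun n i k hk s hs => ?_) (fun n i k hk => ?_) (by fun_prop)
  · exact (Finset.sum_congr rfl fun i _ => ePlus_succ μ i hf x t).trans
      (sum_embedding_castSucc fun i k => ∫ s in (min (x k) t)..(x k),
        Complex.exp (Complex.I * μ * (t - s)) *
          ePlus μ i f (Fin.cons (α := fun _ => ℝ) (x k) (Function.update x k s)))
  · obtain ⟨m, rfl⟩ := hk
    rw [ePlus_cons, descIntegral, if_neg, mul_zero]
    intro h
    have hanti := (Fin.strictAnti_iff_succ_lt.mpr h) (Fin.castSucc_lt_last m)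
    simp only [Fin.snoc_castSucc, Function.update_self, Fin.snoc_last] at hanti
    exact lt_asymm hanti hs.2
  · have hne : ∀ m, i m ≠ k := fun m hm => hk ⟨m, hm⟩
    simp only [ePlus_cons, Function.update_of_ne (hne _)]
    refine continuous_const.mul (continuous_descIntegral _ ?_)
    exact continuous_creationKernel μ i hf
      (continuous_const.update k continuous_fst) continuous_snd

theorem psi_eq_bMinus (γ : ℝ) {N : ℕ} (lam : Fin (N + 1) → ℂ) :
    psi γ lam = bMinus γ (lam (Fin.last N)) (psi γ fun j : Fin N => lam j.castSucc) :=
  eq_of_snoc_equation (psi_snoc γ lam) (bMinus_snoc γ _ (continuous_psi γ _))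

theorem psi_eq_bPlus (γ : ℝ) {N : ℕ} (lam : Fin (N + 1) → ℂ) :
    psi γ lam = bPlus γ (lam 0) (psi γ fun j : Fin N => lam j.succ) :=
  eq_of_cons_equation (psi_cons γ lam) (bPlus_cons γ _ (continuous_psi γ _))

theorem psi_eq_minusChain (γ : ℝ) {N : ℕ} (lam : Fin N → ℂ) :
    psi γ lam = minusChain γ lam := by
  induction N with
  | zero => exact congrArg (psi γ) (Subsingleton.elim _ _)
  | succ N ih => rw [psi_eq_bMinus, ih]; rfl

theorem psi_eq_plusChain (γ : ℝ) {N : ℕ} (lam : Fin N → ℂ) :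
    psi γ lam = plusChain γ lam := by
  induction N with
  | zero => exact congrArg (psi γ) (Subsingleton.elim _ _)
  | succ N ih => rw [psi_eq_bPlus, ih]; rfl

end QNLS

end

theorem mainTheorem2 (γ : ℝ) :
    (∀ (N : ℕ) (lam : Fin (N + 1) → ℂ),
      QNLS.psi γ lam
          = QNLS.bMinus γ (lam (Fin.last N)) (QNLS.psi γ (fun j : Fin N => lam j.castSucc)) ∧
      QNLS.psi γ lam
          = QNLS.bPlus γ (lam 0) (QNLS.psi γ (fun j : Fin N => lam j.succ))) ∧
    (∀ (N : ℕ) (lam : Fin N → ℂ),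
      QNLS.psi γ lam = QNLS.minusChain γ lam ∧
      QNLS.psi γ lam = QNLS.plusChain γ lam ∧
      QNLS.psi γ lam ∈ QNLS.CBInf N) :=
  ⟨fun _ lam => ⟨QNLS.psi_eq_bMinus γ lam, QNLS.psi_eq_bPlus γ lam⟩, fun _ lam =>
    ⟨QNLS.psi_eq_minusChain γ lam, QNLS.psi_eq_plusChain γ lam, QNLS.psi_mem_CBInf γ lam⟩⟩
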